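/- Let $V$ be a finite set of agents, $E\subseteq V\times V$ a set of directed edges with weights $w:E\to(0,1]$, $\mathcal P=\{1,\dots,h\}$ a set of products, $P$ a map assigning to each agent $v$ a nonempty set $P(v)\subseteq\mathcal P$ of available products, $\theta:V\times\mathcal P\to(0,1]$ a threshold function, and $c_0\in(0,1]$ a constant. Put $N(v)=\{i : (i,v)\in E\}$. In the Apt--Simon social network game given by these data, each agent $v$ chooses a product $s_v\in P(v)$, and its utility under the joint strategy $s$ is $$\overline u_v(s)=\begin{cases} c_0 & \text{if } N(v)=\emptyset,\\[2pt] \dfrac12+\dfrac1{2|N(v)|}\Bigl(\displaystyle\sum_{i\in N(v),\,s_i=s_v} w(i,v)\;-\;\theta(v,s_v)\Bigr) & \text{otherwise.}\end{cases}$$ A joint strategy $s$ is a (pure) Nash equilibrium if $\overline u_v(s')\le \overline u_v(s)$ for every agent $v$ and every joint strategy $s'$ that differs from $s$ at most in the choice of $v$. Theorem. Every Apt--Simon social network game with exactly two products ($|\mathcal P|=2$) has a Nash equilibrium. Moreover, a Nash equilibrium can be computed in polynomial time: there is a deterministic polynomial-time Turing machine which, given any such game with $V=\{1,\dots,n\}$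 and rational $w,\theta,c_0$ (presented as a word listing $c_0$ and, for each agent, its available products, its thresholds and its column of the weighted adjacency matrix, with numerators and denominators in binary), outputs the list $(s_1,\dots,s_n)$ of a Nash equilibrium $s$. -/

import Mathlib

/-- An Apt–Simon social network game with agents `V` and products `{1, …, h}` (here `Fin h`), whose
numerical data lie in the ordered field `K`: a directed graph with edge set `E`, whose edges carry
weights in `(0, 1]`, a nonempty set `P v` of available products for each agent, thresholds in
`(0, 1]`, and a constant `c₀ ∈ (0, 1]`. The values of `W` outside `E` are never used. -/
structure SocialNetworkGame (K : Type*) [Field K] [LinearOrder K] (V : Type*) (h : ℕ) where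
  E : Finset (V × V)
  W : V × V → K
  W_mem : ∀ e ∈ E, W e ∈ Set.Ioc 0 1
  P : V → Finset (Fin h)
  P_nonempty : ∀ v, (P v).Nonempty
  θ : V → Fin h → K
  θ_mem : ∀ v t, θ v t ∈ Set.Ioc 0 1
  c₀ : K
  c₀_mem : c₀ ∈ Set.Ioc 0 1

namespace SocialNetworkGame

section Basic

variable {K : Type*} [Field K] [LinearOrder K] {V : Type*} [Fintype V] [DecidableEq V] {h : ℕ}

/-- The set `N(v) = {i | (i, v) ∈ E}` of in-neighbours of `v`. -/
def nbhd (G : SocialNetworkGame K V h) (v : V) : Finset V :=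
  Finset.univ.filter fun i => (i, v) ∈ G.E

/-- The utility of agent `v` under the joint strategy `s`. -/
def utility (G : SocialNetworkGame K V h) (v : V) (s : V → Fin h) : K :=
  if G.nbhd v = ∅ then G.c₀
  else 1 / 2 + 1 / (2 * ((G.nbhd v).card : K)) *
    ((∑ i ∈ (G.nbhd v).filter (fun i => s i = s v), G.W (i, v)) - G.θ v (s v))

/-- A joint strategy `s` (each agent picks one of its available products) is a (pure) Nash
equilibrium if no agent can increase its utility by switching alone to another available
product. -/
def IsNash (G : SocialNetworkGame K V h) (s : V → Fin h) : Prop :=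
  (∀ v, s v ∈ G.P v) ∧
    ∀ v, ∀ t ∈ G.P v, G.utility v (Function.update s v t) ≤ G.utility v s

end Basic

/-- The input alphabet for games with rational data: binary digits (also used as flags), the
separator between numerator and denominator, an end mark for numbers, a mark for a missing edge,
and a mark that opens the block of an agent. -/
inductive Sym where
  | bit (b : Bool)
  | slash
  | endNum
  | noEdge
  | agent
  deriving DecidableEq, Fintype

/-- A natural number in binary, least significant digit first (`0` is the empty word). -/
def encodeNum (n : ℕ) : List Sym :=
  (Computability.encodeNat n).map Sym.bit

/-- A nonnegative rational number in lowest terms, numerator and denominator in binary. -/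
def encodeRat (q : ℚ) : List Sym :=
  encodeNum q.num.natAbs ++ Sym.slash :: (encodeNum q.den ++ [Sym.endNum])

/-- The block of agent `v`: for each product, whether it is available to `v` and the threshold,
followed by the column of the weighted adjacency matrix that belongs to `v`. -/
def encodeAgent {n h : ℕ} (G : SocialNetworkGame ℚ (Fin n) h) (v : Fin n) : List Sym :=
  Sym.agent ::
    (((List.finRange h).flatMap fun t => Sym.bit (decide (t ∈ G.P v)) :: encodeRat (G.θ v t)) ++
      (List.finRange n).flatMap fun i =>
        if (i, v) ∈ G.E then encodeRat (G.W (i, v)) else [Sym.noEdge])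

/-- The word that presents a game with rational data to a machine: `c₀`, then the agents' blocks. -/
def encode {h : ℕ} (G : (n : ℕ) × SocialNetworkGame ℚ (Fin n) h) : List Sym :=
  encodeRat G.2.c₀ ++ (List.finRange G.1).flatMap (encodeAgent G.2)

end SocialNetworkGame

/-! Identify a joint strategy with the set `T` of agents that choose the second product. As there
are only two products, enlarging `T` raises the support of the second product at every agent and
lowers that of the first, so `G.wants` is monotone (`wants_mono`). Its fixed points are Nash
equilibria (`isNash_strategy`): a loop counts equally for both options, and an agent that is
indifferent may as well keep the first product. Knaster–Tarski supplies a fixed point.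

For an algorithm, let `T` grow from the empty set by asking the agents in turn whether they want to
join. By monotonicity nobody who joined regrets it (`ask_le_wants`). A round without change shows
that nobody else wants to join, and every other round gains an agent, so as many rounds as there are
agents suffice (`wants_iterate_ask`).

These rounds are carried out by a sweep program: the input word is read once per round, and each
symbol triggers one pass of a finite transducer over as many cells as the word has symbols. A stack
machine simulates this in cubic time (`run_eval`). The cells store, in binary, two fractions with a
common denominator, the two sides of the comparison in `wants`, updated digit by digit as numbers
are read. Arithmetic is modulo `2 ^ n` for `n` cells, but the entries are bounded through the number
of symbols read, so nothing overflows (`run_encodeRat`). Reading the block of `v` amounts to `join`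
at `v` (`run_encodeAgent`), and reading the word amounts to `ask` (`Ready.round`). -/

open Turing StateTransition

/-! ### Sweep programs and their simulation by a stack machine -/

/-- A sweep program: every input symbol triggers one left-to-right pass of a finite transducer with
states `W` over a list of cells, framed by a finite control `Q`. -/
structure SweepProgram (A Q W C B : Type) where
  q₀ : Q
  c₀ : C
  start : Option A → Q → W
  act : W → C → W × C
  fin : W → Q
  out : C → Option B

/-- One left-to-right pass of a transducer over a list. -/
def sweep {W C : Type} (g : W → C → W × C) : W → List C → W × List C
  | w, [] => (w, [])
  | w, c :: l => ((sweep g (g w c).1 l).1, (g w c).2 :: (sweep g (g w c).1 l).2)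

@[simp] theorem length_sweep {W C : Type} (g : W → C → W × C) (w : W) (l : List C) :
    (sweep g w l).2.length = l.length := by
  induction l generalizing w with
  | nil => rfl
  | cons c l ih => simp [sweep, ih]

namespace SweepProgram

variable {A Q W C B : Type} (P : SweepProgram A Q W C B)

/-- The effect of one input symbol (or of the end of the word). -/
def symbol (x : Q × List C) (a : Option A) : Q × List C :=
  let r := sweep P.act (P.start a x.1) x.2
  (P.fin r.1, r.2)

/-- The effect of one reading of the input word. -/
def round (u : List A) (x : Q × List C) : Q × List C :=
  (u.map some ++ [none]).foldl P.symbol x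

/-- The word is read as often as it has symbols, over as many cells; the result is read off. -/
def eval (u : List A) : List B :=
  ((P.round u)^[u.length] (P.q₀, List.replicate u.length P.c₀)).2.filterMap P.out

@[simp] theorem length_symbol (x : Q × List C) (a : Option A) :
    (P.symbol x a).2.length = x.2.length := by
  simp [symbol]

theorem length_foldl_symbol (l : List (Option A)) (x : Q × List C) :
    (l.foldl P.symbol x).2.length = x.2.length := by
  induction l generalizing x with
  | nil => rfl
  | cons a l ih => simp [ih]

@[simp] theorem length_round (u : List A) (x : Q × List C) :
    (P.round u x).2.length = x.2.length :=
  P.length_foldl_symbol _ _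

theorem length_iterate_round (u : List A) (m : ℕ) (x : Q × List C) :
    ((P.round u)^[m] x).2.length = x.2.length := by
  induction m generalizing x with
  | zero => rfl
  | succ m ih => simp [ih]

/-! ### The stack machine -/

/-- The stacks of the machine. -/
inductive Stk where
  | inp | done | work | temp | clock | out
  deriving DecidableEq

instance : Fintype Stk :=
  ⟨{.inp, .done, .work, .temp, .clock, .out}, fun x => by cases x <;> simp⟩

/-- The labels of the machine. -/
inductive Lbl where
  | load | rewind | round | scan | sweep | unsweep | drain | collect | emit
  deriving DecidableEq

instance : Fintype Lbl :=
  ⟨{.load, .rewind, .round, .scan, .sweep, .unsweep, .drain, .collect, .emit},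
    fun x => by cases x <;> simp⟩

/-- The alphabets of the stacks. -/
@[reducible] def Alph (A C B : Type) : Stk → Type
  | .inp => A
  | .done => A
  | .work => C
  | .temp => C
  | .clock => Unit
  | .out => B

/-- The finite memory of the machine. -/
@[reducible] def Mem (A Q W C : Type) : Type := Q × W × Option A × Option C × Bool

/-- The initial memory. -/
def mem₀ : Mem A Q W C := (P.q₀, P.start none P.q₀, none, none, false)

open TM2.Stmt in
/-- The code of the machine. -/
def code [Inhabited A] [Inhabited B] : Lbl → TM2.Stmt (Alph A C B) Lbl (Mem A Q W C)
  | .load =>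
    pop Stk.inp (fun v a => (v.1, v.2.1, a, v.2.2.2)) <|
    branch (fun v => v.2.2.1.isSome)
      (push Stk.done (fun v => v.2.2.1.getD default) <| push Stk.work (fun _ => P.c₀) <|
        push Stk.clock (fun _ => ()) <| goto fun _ => .load)
      (goto fun _ => .rewind)
  | .rewind =>
    pop Stk.done (fun v a => (v.1, v.2.1, a, v.2.2.2)) <|
    branch (fun v => v.2.2.1.isSome)
      (push Stk.inp (fun v => v.2.2.1.getD default) <| goto fun _ => .rewind)
      (goto fun _ => .round)
  | .round =>
    pop Stk.clock (fun v a => (v.1, v.2.1, v.2.2.1, v.2.2.2.1, a.isSome)) <|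
    branch (fun v => v.2.2.2.2) (goto fun _ => .scan) (goto fun _ => .drain)
  | .scan =>
    pop Stk.inp (fun v a => (v.1, P.start a v.1, a, v.2.2.2)) <|
    branch (fun v => v.2.2.1.isSome)
      (push Stk.done (fun v => v.2.2.1.getD default) <| goto fun _ => .sweep)
      (goto fun _ => .sweep)
  | .sweep =>
    pop Stk.work (fun v c => (v.1, v.2.1, v.2.2.1, c, v.2.2.2.2)) <|
    branch (fun v => v.2.2.2.1.isSome)
      (push Stk.temp (fun v => (P.act v.2.1 (v.2.2.2.1.getD P.c₀)).2) <|
        load (fun v => (v.1, (P.act v.2.1 (v.2.2.2.1.getD P.c₀)).1, v.2.2)) <|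
        goto fun _ => .sweep)
      (goto fun _ => .unsweep)
  | .unsweep =>
    pop Stk.temp (fun v c => (v.1, v.2.1, v.2.2.1, c, v.2.2.2.2)) <|
    branch (fun v => v.2.2.2.1.isSome)
      (push Stk.work (fun v => v.2.2.2.1.getD P.c₀) <| goto fun _ => .unsweep)
      (load (fun v => (P.fin v.2.1, v.2)) <|
        branch (fun v => v.2.2.1.isSome) (goto fun _ => .scan) (goto fun _ => .rewind))
  | .drain =>
    pop Stk.inp (fun v a => (v.1, v.2.1, a, v.2.2.2)) <|
    branch (fun v => v.2.2.1.isSome) (goto fun _ => .drain) (goto fun _ => .collect)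
  | .collect =>
    pop Stk.work (fun v c => (v.1, v.2.1, v.2.2.1, c, v.2.2.2.2)) <|
    branch (fun v => v.2.2.2.1.isSome)
      (push Stk.temp (fun v => v.2.2.2.1.getD P.c₀) <| goto fun _ => .collect)
      (goto fun _ => .emit)
  | .emit =>
    pop Stk.temp (fun v c => (v.1, v.2.1, v.2.2.1, c, v.2.2.2.2)) <|
    branch (fun v => v.2.2.2.1.isSome)
      (branch (fun v => (P.out (v.2.2.2.1.getD P.c₀)).isSome)
        (push Stk.out (fun v => (P.out (v.2.2.2.1.getD P.c₀)).getD default) <|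
          goto fun _ => .emit)
        (goto fun _ => .emit))
      (load (fun _ => P.mem₀) halt)

/-- A valuation of the six stacks. -/
def stk (i d : List A) (w t : List C) (k : List Unit) (o : List B) : ∀ x, List (Alph A C B x)
  | .inp => i
  | .done => d
  | .work => w
  | .temp => t
  | .clock => k
  | .out => o

section update

variable (i d i' d' : List A) (w t w' t' : List C) (k k' : List Unit) (o o' : List B)

theorem update_inp : Function.update (stk i d w t k o) .inp i' = stk i' d w t k o := by
  funext x; cases x <;> rfl
theorem update_done : Function.update (stk i d w t k o) .done d' = stk i d' w t k o := by
  funext x; cases x <;> rfl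
theorem update_work : Function.update (stk i d w t k o) .work w' = stk i d w' t k o := by
  funext x; cases x <;> rfl
theorem update_temp : Function.update (stk i d w t k o) .temp t' = stk i d w t' k o := by
  funext x; cases x <;> rfl
theorem update_clock : Function.update (stk i d w t k o) .clock k' = stk i d w t k' o := by
  funext x; cases x <;> rfl
theorem update_out : Function.update (stk i d w t k o) .out o' = stk i d w t k o' := by
  funext x; cases x <;> rfl

end update

/-- `b` is reached from `a` in at most `n` steps. -/
def ReachesIn {σ : Type*} (f : σ → Option σ) (n : ℕ) (a b : σ) : Prop :=
  ∃ m ≤ n, (flip bind f)^[m] (some a) = some b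

namespace ReachesIn

variable {σ : Type*} {f : σ → Option σ} {a b c : σ} {m n : ℕ}

theorem trans (h₁ : ReachesIn f m a b) (h₂ : ReachesIn f n b c) : ReachesIn f (m + n) a c := by
  obtain ⟨k, hk, h⟩ := h₁
  obtain ⟨l, hl, h'⟩ := h₂
  exact ⟨l + k, by omega, by rw [Function.iterate_add_apply, h, h']⟩

theorem mono (h₁ : ReachesIn f m a b) (h : m ≤ n) : ReachesIn f n a b :=
  let ⟨k, hk, h'⟩ := h₁
  ⟨k, hk.trans h, h'⟩

theorem head (h : f a = some b) (h' : ReachesIn f n b c) : ReachesIn f (n + 1) a c := by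
  rw [add_comm]
  exact trans ⟨1, le_rfl, h⟩ h'

theorem single (h : f a = some b) : ReachesIn f 1 a b := ⟨1, le_rfl, h⟩

end ReachesIn

variable [Inhabited A] [Inhabited B]

/-- A configuration of the machine. -/
@[reducible] def cfg (l : Lbl) (v : Mem A Q W C) (i d : List A) (w t : List C) (k : List Unit)
    (o : List B) : TM2.Cfg (Alph A C B) Lbl (Mem A Q W C) :=
  ⟨some l, v, stk i d w t k o⟩

-- Running times of the phases of the machine

local notation "Run" => ReachesIn (TM2.step (code P))

variable {P}

/-- Each symbol read supplies one work cell and one clock tick; this fixes the number of cells and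
of rounds. Here and below only those components of the final memory are described on which later
phases depend. -/
theorem run_load (v : Mem A Q W C) (u d : List A) (w : List C) (k : List Unit) :
    ∃ v', v'.1 = v.1 ∧ Run (u.length + 1) (cfg .load v u d w [] k [])
      (cfg .rewind v' [] (u.reverse ++ d) (List.replicate u.length P.c₀ ++ w) []
        (List.replicate u.length () ++ k) []) := by
  induction u generalizing v d w k with
  | nil =>
    refine ⟨(v.1, v.2.1, none, v.2.2.2), rfl, .single ?_⟩
    simp [cfg, code, stk, update_inp]
  | cons a u ih =>
    obtain ⟨v', hv, h⟩ := ih (v.1, v.2.1, some a, v.2.2.2) (a :: d) (P.c₀ :: w) (() :: k)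
    refine ⟨v', hv, .head ?_ (by simpa [List.replicate_succ'] using h)⟩
    simp [cfg, code, stk, update_inp, update_done, update_work, update_clock]

theorem run_rewind (v : Mem A Q W C) (u d : List A) (w : List C) (k : List Unit) :
    ∃ v', v'.1 = v.1 ∧ Run (d.length + 1) (cfg .rewind v u d w [] k [])
      (cfg .round v' (d.reverse ++ u) [] w [] k []) := by
  induction d generalizing v u with
  | nil =>
    refine ⟨(v.1, v.2.1, none, v.2.2.2), rfl, .single ?_⟩
    simp [cfg, code, stk, update_done]
  | cons a d ih =>
    obtain ⟨v', hv, h⟩ := ih (v.1, v.2.1, some a, v.2.2.2) (a :: u)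
    refine ⟨v', hv, .head ?_ (by simpa using h)⟩
    simp [cfg, code, stk, update_inp, update_done]

theorem run_sweep (v : Mem A Q W C) (u d : List A) (w t : List C) (k : List Unit) :
    ∃ v', v'.2.1 = (sweep P.act v.2.1 w).1 ∧ v'.2.2.1 = v.2.2.1 ∧
      Run (w.length + 1) (cfg .sweep v u d w t k [])
      (cfg .unsweep v' u d [] ((sweep P.act v.2.1 w).2.reverse ++ t) k []) := by
  induction w generalizing v t with
  | nil =>
    refine ⟨(v.1, v.2.1, v.2.2.1, none, v.2.2.2.2), rfl, rfl, .single ?_⟩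
    simp [cfg, code, stk, update_work, sweep]
  | cons c w ih =>
    obtain ⟨v', hv, hv', h⟩ := ih (v.1, (P.act v.2.1 c).1, v.2.2.1, some c, v.2.2.2.2)
      ((P.act v.2.1 c).2 :: t)
    refine ⟨v', hv, hv', .head ?_ (by simpa [sweep] using h)⟩
    simp [cfg, code, stk, update_work, update_temp]

theorem run_unsweep (v : Mem A Q W C) (u d : List A) (w t : List C) (k : List Unit) :
    ∃ v', v'.1 = P.fin v.2.1 ∧ Run (t.length + 1) (cfg .unsweep v u d w t k [])
      (cfg (if v.2.2.1.isSome then .scan else .rewind) v' u d (t.reverse ++ w) [] k []) := by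
  induction t generalizing v w with
  | nil =>
    refine ⟨(P.fin v.2.1, v.2.1, v.2.2.1, none, v.2.2.2.2), rfl, .single ?_⟩
    cases h : v.2.2.1 <;> simp [cfg, code, stk, update_temp, h]
  | cons c t ih =>
    obtain ⟨v', hv, h⟩ := ih (v.1, v.2.1, v.2.2.1, some c, v.2.2.2.2) (c :: w)
    refine ⟨v', hv, .head ?_ (by simpa using h)⟩
    simp [cfg, code, stk, update_work, update_temp]

/-- The sweep moves the cells to `temp` in reverse order and the return trip restores the order. An
empty input stack pops `none`, which is the end symbol, so both kinds of symbol are treated at once.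
-/
theorem run_scan (v : Mem A Q W C) (u d : List A) (w : List C) (k : List Unit) :
    ∃ v', v'.1 = (P.symbol (v.1, w) u.head?).1 ∧
      Run (2 * w.length + 3) (cfg .scan v u d w [] k [])
        (cfg (if u.head?.isSome then .scan else .rewind) v' u.tail (u.head?.toList ++ d)
          (P.symbol (v.1, w) u.head?).2 [] k []) := by
  obtain ⟨v₁, h₁, h₁', r₁⟩ := run_sweep (P := P) (v.1, P.start u.head? v.1, u.head?, v.2.2.2) u.tail
    (u.head?.toList ++ d) w [] k
  obtain ⟨v₂, h₂, r₂⟩ := run_unsweep (P := P) v₁ u.tail (u.head?.toList ++ d) []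
    ((sweep P.act (P.start u.head? v.1) w).2.reverse ++ []) k
  refine ⟨v₂, by rw [h₂, h₁]; rfl, ?_⟩
  have r₀ : Run 1 (cfg .scan v u d w [] k [])
      (cfg .sweep (v.1, P.start u.head? v.1, u.head?, v.2.2.2) u.tail (u.head?.toList ++ d)
        w [] k []) := by
    refine .single ?_
    cases u <;> simp [cfg, code, stk, update_inp, update_done]
  have h := ((r₀.trans r₁).trans r₂).mono (n := 2 * w.length + 3) (by simp; omega)
  rw [h₁'] at h
  simpa [symbol] using h

theorem run_scans (v : Mem A Q W C) (u d : List A) (w : List C) (k : List Unit) :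
    ∃ v', v'.1 = (P.round u (v.1, w)).1 ∧
      Run ((u.length + 1) * (2 * w.length + 3)) (cfg .scan v u d w [] k [])
        (cfg .rewind v' [] (u.reverse ++ d) (P.round u (v.1, w)).2 [] k []) := by
  induction u generalizing v d w with
  | nil =>
    obtain ⟨v', h, r⟩ := run_scan (P := P) v [] d w k
    exact ⟨v', h, by simpa [round] using r⟩
  | cons a u ih =>
    obtain ⟨v₁, h₁, r₁⟩ := run_scan (P := P) v (a :: u) d w k
    obtain ⟨v₂, h₂, r₂⟩ := ih v₁ (a :: d) (P.symbol (v.1, w) (some a)).2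
    have e : P.round u (v₁.1, (P.symbol (v.1, w) (some a)).2) = P.round (a :: u) (v.1, w) := by
      rw [h₁]; rfl
    rw [e] at h₂ r₂
    refine ⟨v₂, h₂, ?_⟩
    have r := r₁.trans r₂
    simp only [length_symbol] at r
    convert r using 1
    · simp only [List.length_cons]; ring
    · simp

theorem run_round (v : Mem A Q W C) (u : List A) (w : List C) (k : List Unit) :
    ∃ v', v'.1 = (P.round u (v.1, w)).1 ∧
      Run ((u.length + 1) * (2 * w.length + 4) + 1) (cfg .round v u [] w [] (() :: k) [])
        (cfg .round v' u [] (P.round u (v.1, w)).2 [] k []) := by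
  obtain ⟨v₁, h₁, r₁⟩ := run_scans (P := P) (v.1, v.2.1, v.2.2.1, v.2.2.2.1, true) u [] w k
  obtain ⟨v₂, h₂, r₂⟩ := run_rewind (P := P) v₁ [] (u.reverse ++ []) (P.round u (v.1, w)).2 k
  refine ⟨v₂, by rw [h₂, h₁], ?_⟩
  have r := (r₁.trans r₂).head (a := cfg .round v u [] w [] (() :: k) [])
    (by simp [cfg, code, stk, update_clock])
  simp only [List.append_nil, List.reverse_reverse, List.length_reverse] at r
  exact r.mono (by ring_nf; omega)

theorem run_rounds (v : Mem A Q W C) (u : List A) (w : List C) (k : List Unit) :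
    ∃ v', v'.1 = ((P.round u)^[k.length] (v.1, w)).1 ∧
      Run (k.length * ((u.length + 1) * (2 * w.length + 4) + 1) + 1)
        (cfg .round v u [] w [] k [])
        (cfg .drain v' u [] ((P.round u)^[k.length] (v.1, w)).2 [] [] []) := by
  induction k generalizing v w with
  | nil =>
    refine ⟨(v.1, v.2.1, v.2.2.1, v.2.2.2.1, false), rfl, .mono (.single ?_) (by simp)⟩
    simp [cfg, code, stk, update_clock]
  | cons x k ih =>
    obtain ⟨v₁, h₁, r₁⟩ := run_round (P := P) v u w k
    obtain ⟨v₂, h₂, r₂⟩ := ih v₁ (P.round u (v.1, w)).2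
    have e : (v₁.1, (P.round u (v.1, w)).2) = P.round u (v.1, w) := by rw [h₁]
    rw [e] at h₂ r₂
    refine ⟨v₂, h₂, ?_⟩
    have r := r₁.trans r₂
    simp only [length_round] at r
    refine r.mono ?_
    simp only [List.length_cons]
    apply le_of_eq; ring

theorem run_drain (v : Mem A Q W C) (u : List A) (w : List C) :
    ∃ v', Run (u.length + 1) (cfg .drain v u [] w [] [] []) (cfg .collect v' [] [] w [] [] []) := by
  induction u generalizing v with
  | nil =>
    refine ⟨(v.1, v.2.1, none, v.2.2.2), .single ?_⟩
    simp [cfg, code, stk, update_inp]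
  | cons a u ih =>
    obtain ⟨v', h⟩ := ih (v.1, v.2.1, some a, v.2.2.2)
    refine ⟨v', .head ?_ h⟩
    simp [cfg, code, stk, update_inp]

/-- The output stack reverses the order in which it is filled, so the cells are turned over
beforehand. -/
theorem run_collect (v : Mem A Q W C) (w t : List C) :
    ∃ v', Run (w.length + 1) (cfg .collect v [] [] w t [] [])
      (cfg .emit v' [] [] [] (w.reverse ++ t) [] []) := by
  induction w generalizing v t with
  | nil =>
    refine ⟨(v.1, v.2.1, v.2.2.1, none, v.2.2.2.2), .single ?_⟩
    simp [cfg, code, stk, update_work]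
  | cons c w ih =>
    obtain ⟨v', h⟩ := ih (v.1, v.2.1, v.2.2.1, some c, v.2.2.2.2) (c :: t)
    refine ⟨v', .head ?_ (by simpa using h)⟩
    simp [cfg, code, stk, update_work, update_temp]

theorem run_emit (v : Mem A Q W C) (t : List C) (o : List B) :
    Run (t.length + 1) (cfg .emit v [] [] [] t [] o)
      ⟨none, P.mem₀, stk [] [] [] [] [] (t.reverse.filterMap P.out ++ o)⟩ := by
  induction t generalizing v o with
  | nil =>
    refine .single ?_
    simp [cfg, code, stk, update_temp]
  | cons c t ih =>
    cases hc : P.out c with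
    | none =>
      refine .head (b := cfg .emit (v.1, v.2.1, v.2.2.1, some c, v.2.2.2.2) [] [] [] t [] o) ?_ ?_
      · simp [cfg, code, stk, update_temp, hc]
      · simpa [hc] using ih (v.1, v.2.1, v.2.2.1, some c, v.2.2.2.2) o
    | some b =>
      refine .head
        (b := cfg .emit (v.1, v.2.1, v.2.2.1, some c, v.2.2.2.2) [] [] [] t [] (b :: o)) ?_ ?_
      · simp [cfg, code, stk, update_temp, update_out, hc]
      · simpa [hc] using ih (v.1, v.2.1, v.2.2.1, some c, v.2.2.2.2) (b :: o)

theorem run_eval (u : List A) :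
    Run (u.length * ((u.length + 1) * (2 * u.length + 4) + 1) + 5 * (u.length + 1) + 1)
      (cfg .load P.mem₀ u [] [] [] [] [])
      ⟨none, P.mem₀, stk [] [] [] [] [] (P.eval u)⟩ := by
  obtain ⟨v₁, h₁, r₁⟩ := run_load (P := P) P.mem₀ u [] [] []
  obtain ⟨v₂, h₂, r₂⟩ := run_rewind (P := P) v₁ [] (u.reverse ++ [])
    (List.replicate u.length P.c₀ ++ []) (List.replicate u.length () ++ [])
  obtain ⟨v₃, h₃, r₃⟩ := run_rounds (P := P) v₂ ((u.reverse ++ []).reverse ++ [])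
    (List.replicate u.length P.c₀ ++ []) (List.replicate u.length () ++ [])
  obtain ⟨v₄, r₄⟩ := run_drain (P := P) v₃ ((u.reverse ++ []).reverse ++ [])
    ((P.round ((u.reverse ++ []).reverse ++ []))^[(List.replicate u.length () ++ []).length]
      (v₂.1, List.replicate u.length P.c₀ ++ [])).2
  obtain ⟨v₅, r₅⟩ := run_collect (P := P) v₄
    ((P.round ((u.reverse ++ []).reverse ++ []))^[(List.replicate u.length () ++ []).length]
      (v₂.1, List.replicate u.length P.c₀ ++ [])).2 []
  have r := ((((r₁.trans r₂).trans r₃).trans r₄).trans r₅).trans (run_emit (P := P) v₅ _ [])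
  have e : v₂.1 = P.q₀ := by rw [h₂, h₁]; rfl
  simp only [e, List.append_nil, List.reverse_reverse, List.length_reverse, List.length_replicate,
    length_iterate_round] at r
  -- Loading, rewinding, draining, collecting and emitting cost `u.length + 1` each; the rounds
  -- account for the rest.
  exact r.mono (by omega)

variable (P) in
/-- The bundled machine. -/
def machine [Fintype A] [Fintype Q] [Fintype W] [Fintype C] : FinTM2 where
  K := Stk
  k₀ := .inp
  k₁ := .out
  Γ := Alph A C B
  Λ := Lbl
  main := .load
  σ := Mem A Q W C
  initialState := P.mem₀
  Γk₀Fin := inferInstanceAs (Fintype A)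
  m := P.code

/-- Sweep programs compute in polynomial time. -/
theorem nonempty_computableInPolyTime [Fintype A] [Fintype Q] [Fintype W] [Fintype C] {α : Type}
    (e : α → List A) (f : α → List B) (h : ∀ a, P.eval (e a) = f a) :
    Nonempty (TM2ComputableInPolyTime e (id : List B → List B) f) := by
  refine ⟨⟨⟨P.machine, Equiv.refl A, Equiv.refl B⟩,
    .X * ((.X + 1) * (2 * .X + 4) + 1) + 5 * (.X + 1) + 1, fun a => ?_⟩⟩
  have r := run_eval (P := P) (e a)
  have hi : initList P.machine (List.map (Equiv.refl A).invFun (e a)) =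
      cfg .load P.mem₀ (e a) [] [] [] [] [] := by
    refine (congrArg (initList P.machine) (List.map_id _)).trans ?_
    refine congrArg (TM2.Cfg.mk (some Lbl.load) P.mem₀) ?_
    funext x; cases x <;> rfl
  have ho : haltList P.machine (List.map (Equiv.refl B).invFun (f a)) =
      ⟨none, P.mem₀, stk [] [] [] [] [] (P.eval (e a))⟩ := by
    rw [h]
    refine (congrArg (haltList P.machine) (List.map_id _)).trans ?_
    refine congrArg (TM2.Cfg.mk none P.mem₀) ?_
    funext x; cases x <;> rfl
  refine ⟨⟨r.choose, ?_⟩, ?_⟩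
  · refine (congrArg _ (congrArg some hi)).trans (r.choose_spec.2.trans ?_)
    exact congrArg some ho.symm
  · refine r.choose_spec.1.trans (le_of_eq ?_)
    simp

end SweepProgram

/-! ### Binary arithmetic by transducers -/

/-- The value of a binary word, least significant digit first. -/
def binVal : List Bool → ℕ
  | [] => 0
  | b :: l => b.toNat + 2 * binVal l

theorem binVal_lt (l : List Bool) : binVal l < 2 ^ l.length := by
  induction l with
  | nil => simp [binVal]
  | cons b l ih => cases b <;> simp [binVal, pow_succ] <;> omega

/-- The carry of a full adder. -/
def carry (x y c : Bool) : Bool := (x && y) || (c && (x ^^ y))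

/-- Addition with carry, without a last carry. -/
def addBits : Bool → List Bool → List Bool → List Bool
  | c, x :: l, y :: m => (x ^^ y ^^ c) :: addBits (carry x y c) l m
  | _, _, _ => []

/-- Shift by one digit, keeping the length. -/
def shiftBits : Bool → List Bool → List Bool
  | s, x :: l => s :: shiftBits x l
  | _, [] => []

/-- The witness `k` is the dropped last carry, so addition of digits is exact modulo `2 ^ l.length`.
-/
theorem exists_binVal_addBits (c : Bool) (l m : List Bool) (h : l.length = m.length) :
    ∃ k, binVal (addBits c l m) + 2 ^ l.length * k = binVal l + binVal m + c.toNat := by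
  induction l generalizing c m with
  | nil =>
    obtain rfl : m = [] := by simpa using h.symm
    exact ⟨c.toNat, by simp [addBits, binVal]⟩
  | cons x l ih =>
    cases m with
    | nil => simp at h
    | cons y m =>
      obtain ⟨k, hk⟩ := ih (carry x y c) m (by simpa using h)
      refine ⟨k, ?_⟩
      have e : 2 ^ (x :: l).length * k = 2 * (2 ^ l.length * k) := by
        rw [List.length_cons, pow_succ]; ring
      rw [e]
      cases x <;> cases y <;> cases c <;> simp [addBits, binVal, carry] at hk ⊢ <;> omega

theorem exists_binVal_shiftBits (s : Bool) (l : List Bool) :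
    ∃ k, binVal (shiftBits s l) + 2 ^ l.length * k = 2 * binVal l + s.toNat := by
  induction l generalizing s with
  | nil => exact ⟨s.toNat, by simp [shiftBits, binVal]⟩
  | cons x l ih =>
    obtain ⟨k, hk⟩ := ih x
    refine ⟨k, ?_⟩
    have e : 2 ^ (x :: l).length * k = 2 * (2 ^ l.length * k) := by
      rw [List.length_cons, pow_succ]; ring
    rw [e]
    simp only [shiftBits, binVal]
    omega

theorem two_pow_cast_eq_zero (n : ℕ) : (2 : ZMod (2 ^ n)) ^ n = 0 := by
  exact_mod_cast ZMod.natCast_self (2 ^ n)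

theorem cast_binVal_addBits {n : ℕ} (c : Bool) (l m : List Bool) (hl : l.length = n)
    (hm : m.length = n) :
    (binVal (addBits c l m) : ZMod (2 ^ n)) = binVal l + binVal m + c.toNat := by
  obtain ⟨k, hk⟩ := exists_binVal_addBits c l m (hl.trans hm.symm)
  have := congrArg (Nat.cast (R := ZMod (2 ^ n))) hk
  push_cast at this
  rwa [hl, two_pow_cast_eq_zero, zero_mul, add_zero] at this

theorem cast_binVal_shiftBits {n : ℕ} (s : Bool) (l : List Bool) (hl : l.length = n) :
    (binVal (shiftBits s l) : ZMod (2 ^ n)) = 2 * binVal l + s.toNat := by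
  obtain ⟨k, hk⟩ := exists_binVal_shiftBits s l
  have := congrArg (Nat.cast (R := ZMod (2 ^ n))) hk
  push_cast at this
  rwa [hl, two_pow_cast_eq_zero, zero_mul, add_zero] at this

theorem binVal_map_false {α : Type} (l : List α) : binVal (l.map fun _ => false) = 0 := by
  induction l with
  | nil => rfl
  | cons x l ih => simp [binVal] at ih ⊢; exact ih

/-- Lexicographic comparison from the most significant digit. -/
def gtBits : Bool → List Bool → List Bool → Bool
  | g, x :: l, y :: m => gtBits (if x = y then g else x) l m
  | g, _, _ => g

/-- The digits arrive least significant first, so each differing pair overrides the verdict `g` on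
the lower digits, which survives only equal pairs. -/
theorem gtBits_eq (g : Bool) (l m : List Bool) (h : l.length = m.length) :
    gtBits g l m = (decide (binVal m < binVal l) || (g && decide (binVal m = binVal l))) := by
  induction l generalizing g m with
  | nil =>
    obtain rfl : m = [] := by simpa using h.symm
    simp [gtBits, binVal]
  | cons x l ih =>
    cases m with
    | nil => simp at h
    | cons y m =>
      rw [gtBits, ih _ m (by simpa using h)]
      rcases lt_trichotomy (binVal m) (binVal l) with hlt | heq | hgt <;>
        cases x <;> cases y <;> cases g <;> rw [Bool.eq_iff_iff] <;> simp [binVal] <;> omega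

/-! ### The registers -/

set_option synthInstance.maxSize 1000 in
/-- A column of binary digits of the seven registers. -/
structure NumCell where
  a : Bool
  a' : Bool
  b : Bool
  b' : Bool
  d : Bool
  d' : Bool
  x : Bool
  deriving Fintype

/-- Commands on the registers: add multiples of the doubled register `x` to `a'` and `b'`; add
`a`, `b`, `d` to `a'`, `b'`, `d'` and double them; take over the results; start anew. -/
inductive NumCmd where
  | nop
  | mulNum (e f : Bool)
  | mulDen (e : Bool)
  | next
  | reset
  deriving Fintype

set_option synthInstance.maxSize 1000 in
/-- Carries, delayed digits, and the comparison of `a'` with `b'`, of a pass over the registers. -/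
structure NumState where
  cmd : NumCmd
  c₁ : Bool
  c₂ : Bool
  c₃ : Bool
  s₁ : Bool
  s₂ : Bool
  s₃ : Bool
  pos : Bool
  deriving Fintype

/-- The transducer of the registers. -/
def numAct (w : NumState) (c : NumCell) : NumState × NumCell :=
  match w.cmd with
  | .nop => (w, c)
  | .mulNum e f =>
    ({w with c₁ := carry c.a' (e && c.x) w.c₁, c₂ := carry c.b' (f && c.x) w.c₂, s₁ := c.x},
      {c with a' := c.a' ^^ (e && c.x) ^^ w.c₁, b' := c.b' ^^ (f && c.x) ^^ w.c₂, x := w.s₁})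
  | .mulDen e =>
    ({w with c₁ := carry c.a' (e && c.a) w.c₁, c₂ := carry c.b' (e && c.b) w.c₂,
             c₃ := carry c.d' (e && c.d) w.c₃, s₁ := c.a, s₂ := c.b, s₃ := c.d},
      {c with a' := c.a' ^^ (e && c.a) ^^ w.c₁, b' := c.b' ^^ (e && c.b) ^^ w.c₂,
              d' := c.d' ^^ (e && c.d) ^^ w.c₃, a := w.s₁, b := w.s₂, d := w.s₃})
  | .next =>
    ({w with pos := if c.a' = c.b' then w.pos else c.a'},
      ⟨c.a', false, c.b', false, c.d', false, c.d'⟩)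
  | .reset => ({w with s₁ := false}, ⟨false, false, false, false, w.s₁, false, w.s₁⟩)

/-- The first state of a pass. -/
def NumState.start (cmd : NumCmd) (pos : Bool) : NumState :=
  ⟨cmd, false, false, false, cmd matches .reset, false, false,
    match cmd with | .next => false | _ => pos⟩

/-- Contents of the registers. -/
@[ext] structure Regs (R : Type) where
  a : R
  a' : R
  b : R
  b' : R
  d : R
  d' : R
  x : R

/-- The effect of a command on the registers. -/
def NumCmd.exec {R : Type} [CommRing R] (r : Regs R) : NumCmd → Regs R
  | .nop => r
  | .mulNum e f => {r with
      a' := r.a' + r.x * e.toNat, b' := r.b' + r.x * f.toNat, x := 2 * r.x}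
  | .mulDen e => {r with
      a' := r.a' + r.a * e.toNat, b' := r.b' + r.b * e.toNat, d' := r.d' + r.d * e.toNat
      a := 2 * r.a, b := 2 * r.b, d := 2 * r.d}
  | .next => ⟨r.a', 0, r.b', 0, r.d', 0, r.d'⟩
  | .reset => ⟨0, 0, 0, 0, 1, 0, 1⟩

/-- The contents of the registers that a list of cells represents. -/
def regs (n : ℕ) (l : List NumCell) : Regs (ZMod (2 ^ n)) where
  a := binVal (l.map NumCell.a)
  a' := binVal (l.map NumCell.a')
  b := binVal (l.map NumCell.b)
  b' := binVal (l.map NumCell.b')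
  d := binVal (l.map NumCell.d)
  d' := binVal (l.map NumCell.d')
  x := binVal (l.map NumCell.x)

theorem sweep_eq_self {W C : Type} {g : W → C → W × C} {w : W} (h : ∀ c, g w c = (w, c))
    (l : List C) : sweep g w l = (w, l) := by
  induction l with
  | nil => rfl
  | cons c l ih => simp [sweep, h, ih]

/-- Arbitrary carries and delayed digits are allowed for the sake of induction. Register `x` is
doubled because every digit is written one cell later. -/
theorem sweep_mulNum (e f c₁ c₂ c₃ s₁ s₂ s₃ p : Bool) (l : List NumCell) :
    let r := sweep numAct ⟨.mulNum e f, c₁, c₂, c₃, s₁, s₂, s₃, p⟩ l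
    r.1.pos = p ∧ r.2.map NumCell.a = l.map NumCell.a ∧ r.2.map NumCell.b = l.map NumCell.b ∧
    r.2.map NumCell.d = l.map NumCell.d ∧ r.2.map NumCell.d' = l.map NumCell.d' ∧
    r.2.map NumCell.a' = addBits c₁ (l.map NumCell.a') (l.map fun c => e && c.x) ∧
    r.2.map NumCell.b' = addBits c₂ (l.map NumCell.b') (l.map fun c => f && c.x) ∧
    r.2.map NumCell.x = shiftBits s₁ (l.map NumCell.x) := by
  induction l generalizing c₁ c₂ c₃ s₁ s₂ s₃ with
  | nil => simp [sweep, addBits, shiftBits]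
  | cons c l ih => simp [sweep, addBits, shiftBits, numAct, ih]

theorem sweep_mulDen (e c₁ c₂ c₃ s₁ s₂ s₃ p : Bool) (l : List NumCell) :
    let r := sweep numAct ⟨.mulDen e, c₁, c₂, c₃, s₁, s₂, s₃, p⟩ l
    r.1.pos = p ∧ r.2.map NumCell.x = l.map NumCell.x ∧
    r.2.map NumCell.a = shiftBits s₁ (l.map NumCell.a) ∧
    r.2.map NumCell.b = shiftBits s₂ (l.map NumCell.b) ∧
    r.2.map NumCell.d = shiftBits s₃ (l.map NumCell.d) ∧
    r.2.map NumCell.a' = addBits c₁ (l.map NumCell.a') (l.map fun c => e && c.a) ∧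
    r.2.map NumCell.b' = addBits c₂ (l.map NumCell.b') (l.map fun c => e && c.b) ∧
    r.2.map NumCell.d' = addBits c₃ (l.map NumCell.d') (l.map fun c => e && c.d) := by
  induction l generalizing c₁ c₂ c₃ s₁ s₂ s₃ with
  | nil => simp [sweep, addBits, shiftBits]
  | cons c l ih => simp [sweep, addBits, shiftBits, numAct, ih]

theorem sweep_next (c₁ c₂ c₃ s₁ s₂ s₃ p : Bool) (l : List NumCell) :
    let r := sweep numAct ⟨.next, c₁, c₂, c₃, s₁, s₂, s₃, p⟩ l
    r.1.pos = gtBits p (l.map NumCell.a') (l.map NumCell.b') ∧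
    r.2 = l.map fun c => ⟨c.a', false, c.b', false, c.d', false, c.d'⟩ := by
  induction l generalizing p with
  | nil => simp [sweep, gtBits]
  | cons c l ih => simp [sweep, gtBits, numAct, ih]

/-- A reset pass starts with the delayed digit `true`; shifted into a row of zeros, it becomes the
number one in `d` and `x`. -/
theorem sweep_reset (c₁ c₂ c₃ s₁ s₂ s₃ p : Bool) (l : List NumCell) :
    let r := sweep numAct ⟨.reset, c₁, c₂, c₃, s₁, s₂, s₃, p⟩ l
    r.1.pos = p ∧
    r.2 = (shiftBits s₁ (l.map fun _ => false)).map
      fun s => ⟨false, false, false, false, s, false, s⟩ := by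
  induction l generalizing s₁ with
  | nil => simp [sweep, shiftBits]
  | cons c l ih => simp [sweep, shiftBits, numAct, ih]

theorem binVal_map_and {α : Type} (e : Bool) (f : α → Bool) (l : List α) :
    binVal (l.map fun c => e && f c) = binVal (l.map f) * e.toNat := by
  cases e
  · simp only [Bool.false_and, binVal_map_false, Bool.toNat_false, mul_zero]
  · simp

/-- A pass over the registers executes its command. -/
theorem regs_sweep {n : ℕ} (cmd : NumCmd) (p : Bool) (l : List NumCell) (hl : l.length = n) :
    regs n (sweep numAct (.start cmd p) l).2 = cmd.exec (regs n l) := by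
  cases cmd with
  | nop => rw [sweep_eq_self (g := numAct) (w := .start .nop p) fun c => rfl]; rfl
  | mulNum e f =>
    obtain ⟨-, h₁, h₂, h₃, h₄, h₅, h₆, h₇⟩ :=
      sweep_mulNum e f false false false false false false p l
    simp only [NumState.start, regs, NumCmd.exec, h₁, h₂, h₃, h₄, h₅, h₆, h₇]
    ext <;> simp [cast_binVal_addBits, cast_binVal_shiftBits, hl, binVal_map_and]
  | mulDen e =>
    obtain ⟨-, h₁, h₂, h₃, h₄, h₅, h₆, h₇⟩ :=
      sweep_mulDen e false false false false false false p l
    simp only [NumState.start, regs, NumCmd.exec, h₁, h₂, h₃, h₄, h₅, h₆, h₇]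
    ext <;> simp [cast_binVal_addBits, cast_binVal_shiftBits, hl, binVal_map_and]
  | next =>
    obtain ⟨-, h⟩ := sweep_next false false false false false false false l
    simp only [NumState.start, regs, NumCmd.exec, h]
    ext <;> simp [Function.comp_def, binVal_map_false, -List.map_const']
  | reset =>
    obtain ⟨-, h⟩ := sweep_reset false false false true false false p l
    simp only [NumState.start, regs, NumCmd.exec, h]
    ext <;> simp [Function.comp_def, binVal_map_false, -List.map_const', cast_binVal_shiftBits, hl]

/-- The sign that a pass over the registers computes. -/
theorem pos_sweep {n : ℕ} (cmd : NumCmd) (p : Bool) (l : List NumCell) (hl : l.length = n) :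
    (sweep numAct (.start cmd p) l).1.pos = match cmd with
      | .next => decide ((regs n l).b'.val < (regs n l).a'.val)
      | _ => p := by
  cases cmd with
  | nop => rw [sweep_eq_self (g := numAct) (w := .start .nop p) fun c => rfl]; rfl
  | mulNum e f => exact (sweep_mulNum e f false false false false false false p l).1
  | mulDen e => exact (sweep_mulDen e false false false false false false p l).1
  | next =>
    have ha : binVal (l.map NumCell.a') < 2 ^ n := by simpa [hl] using binVal_lt (l.map NumCell.a')
    have hb : binVal (l.map NumCell.b') < 2 ^ n := by simpa [hl] using binVal_lt (l.map NumCell.b')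
    refine (sweep_next false false false false false false false l).1.trans ?_
    rw [gtBits_eq _ _ _ (by simp)]
    simp [regs, ZMod.val_natCast, Nat.mod_eq_of_lt ha, Nat.mod_eq_of_lt hb]
  | reset => exact (sweep_reset false false false true false false p l).1

/-! ### The agents -/

/-- The data of an agent: whether the second product is chosen, whether this is the agent whose
block is read, whether this is the agent whose edge is read, whether there is such an agent. -/
structure AgentCell where
  s : Bool
  cur : Bool
  ptr : Bool
  live : Bool
  deriving Fintype

/-- Moves of a mark along the cells. -/
inductive MarkMove where
  | set | shift | clear
  deriving DecidableEq

instance : Fintype MarkMove := ⟨{.set, .shift, .clear}, fun x => by cases x <;> simp⟩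

/-- Commands on the agents: decide the choice of the current agent and move on; move the edge
mark. -/
inductive AgentCmd where
  | nop
  | commit (go : Bool) (mv : MarkMove)
  | point (mv : MarkMove)
  deriving Fintype

/-- The state of a pass over the agents. -/
structure AgentState where
  cmd : AgentCmd
  m : Bool
  ea : Bool
  eb : Bool
  deriving Fintype

/-- The transducer of the agents. -/
def agentAct (w : AgentState) (c : AgentCell) : AgentState × AgentCell :=
  match w.cmd with
  | .nop => (w, c)
  | .commit go mv =>
    ({w with m := decide (mv = .shift) && c.cur},
      ⟨c.s || (c.cur && go), w.m, false, c.live || w.m⟩)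
  | .point mv =>
    (⟨w.cmd, decide (mv = .shift) && c.ptr, if w.m then c.s && !c.cur else w.ea,
      if w.m then !c.s && !c.cur else w.eb⟩, {c with ptr := w.m})

/-- The first state of a pass over the agents. -/
def AgentState.start (cmd : AgentCmd) (ea eb : Bool) : AgentState :=
  ⟨cmd, match cmd with | .nop => false | .commit _ mv => mv = .set | .point mv => mv = .set, ea, eb⟩

/-- The new place of a mark (places are numbered from `1`, and `0` stands for no mark). -/
def MarkMove.apply (c : ℕ) : MarkMove → ℕ
  | .set => 1
  | .shift => if c = 0 then 0 else c + 1
  | .clear => 0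

/-- The contents of the agents' cells. -/
structure Agents where
  S : ℕ → Bool
  live : ℕ → Bool
  cur : ℕ
  ptr : ℕ

/-- The cell of an agent. -/
def Agents.cell (A : Agents) (j : ℕ) : AgentCell :=
  ⟨A.S j, A.cur = j + 1, A.ptr = j + 1, A.live j⟩

/-- The effect of a command on the agents. -/
def AgentCmd.exec (A : Agents) : AgentCmd → Agents
  | .nop => A
  | .commit go mv =>
    ⟨fun j => A.S j || (decide (A.cur = j + 1) && go),
      fun j => A.live j || decide (mv.apply A.cur = j + 1), mv.apply A.cur, 0⟩
  | .point mv => {A with ptr := mv.apply A.ptr}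

/-- The flags that say whether the edge read counts for or against the second product. -/
def AgentCmd.fetch (n : ℕ) (A : Agents) (e : Bool × Bool) : AgentCmd → Bool × Bool
  | .point mv =>
    if mv.apply A.ptr ∈ Set.Icc 1 n then
      (A.S (mv.apply A.ptr - 1) && !decide (A.cur = mv.apply A.ptr),
        !A.S (mv.apply A.ptr - 1) && !decide (A.cur = mv.apply A.ptr))
    else e
  | _ => e

/-- Invariant: on entering cell `k`, the flag `m` tells whether the moved mark belongs there, that
is, at place `k + 1`. -/
theorem sweep_commit (A : Agents) (go ea eb : Bool) (mv : MarkMove) (k n : ℕ) :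
    let r := sweep agentAct ⟨.commit go mv, mv.apply A.cur = k + 1, ea, eb⟩
      ((List.range' k n).map A.cell)
    r.1.ea = ea ∧ r.1.eb = eb ∧
      r.2 = (List.range' k n).map (AgentCmd.exec A (.commit go mv)).cell := by
  induction n generalizing k with
  | zero => simp [sweep]
  | succ n ih =>
    -- Only a shift can carry the mark past the first place, and it does so from the cell just left.
    have e : (decide (mv = .shift) && (A.cell k).cur) = decide (mv.apply A.cur = k + 1 + 1) := by
      cases mv <;> simp [MarkMove.apply, Agents.cell]
      split_ifs <;> simp_all
    simp only [List.range'_succ, List.map_cons, sweep, agentAct, e]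
    obtain ⟨h₁, h₂, h₃⟩ := ih (k + 1)
    refine ⟨h₁, h₂, ?_⟩
    rw [h₃]
    congr 1

/-- The flags are overwritten exactly in the cell where the mark lands; if that place lies outside
the cells swept, the old flags survive. -/
theorem sweep_point (A : Agents) (ea eb : Bool) (mv : MarkMove) (k n : ℕ) :
    let r := sweep agentAct ⟨.point mv, mv.apply A.ptr = k + 1, ea, eb⟩
      ((List.range' k n).map A.cell)
    (r.1.ea, r.1.eb) = (if mv.apply A.ptr ∈ Set.Icc (k + 1) (k + n) then
      (A.S (mv.apply A.ptr - 1) && !decide (A.cur = mv.apply A.ptr),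
        !A.S (mv.apply A.ptr - 1) && !decide (A.cur = mv.apply A.ptr)) else (ea, eb)) ∧
      r.2 = (List.range' k n).map (AgentCmd.exec A (.point mv)).cell := by
  induction n generalizing k ea eb with
  | zero => simp [sweep]
  | succ n ih =>
    have e : (decide (mv = .shift) && (A.cell k).ptr) = decide (mv.apply A.ptr = k + 1 + 1) := by
      cases mv <;> simp [MarkMove.apply, Agents.cell]
      split_ifs <;> simp_all
    simp only [List.range'_succ, List.map_cons, sweep, agentAct, e]
    obtain ⟨h₁, h₂⟩ := ih (if decide (mv.apply A.ptr = k + 1) = true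
      then (A.cell k).s && !(A.cell k).cur else ea) (if decide (mv.apply A.ptr = k + 1) = true
      then !(A.cell k).s && !(A.cell k).cur else eb) (k + 1)
    constructor
    · rw [h₁]
      simp only [Set.mem_Icc, Agents.cell, decide_eq_true_eq]
      generalize mv.apply A.ptr = p
      by_cases hp : p = k + 1
      · subst hp; simp
      · rw [if_neg hp, if_neg hp]
        congr 1
        simp only [eq_iff_iff]
        omega
    · rw [h₂]
      congr 1

theorem agents_sweep (A : Agents) (cmd : AgentCmd) (ea eb : Bool) (n : ℕ) :
    let r := sweep agentAct (.start cmd ea eb) ((List.range n).map A.cell)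
    (r.1.ea, r.1.eb) = cmd.fetch n A (ea, eb) ∧ r.2 = (List.range n).map (cmd.exec A).cell := by
  have hm (mv : MarkMove) (c : ℕ) : decide (mv = .set) = decide (mv.apply c = 0 + 1) := by
    cases mv <;> simp [MarkMove.apply]
    split_ifs <;> simp_all
  rw [List.range_eq_range']
  cases cmd with
  | nop =>
    rw [sweep_eq_self (g := agentAct) (w := .start .nop ea eb) fun c => rfl]
    exact ⟨rfl, rfl⟩
  | commit go mv =>
    obtain ⟨h₁, h₂, h₃⟩ := sweep_commit A go ea eb mv 0 n
    rw [← hm] at h₁ h₂ h₃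
    exact ⟨Prod.ext h₁ h₂, h₃⟩
  | point mv =>
    have h := sweep_point A ea eb mv 0 n
    rw [← hm] at h
    simpa [AgentCmd.fetch, AgentState.start] using h

/-! ### The program -/

namespace SocialNetworkGame

/-- The numbers in a block. -/
inductive Item where
  | fst | snd | edge
  deriving DecidableEq

instance : Fintype Item := ⟨{Item.fst, Item.snd, Item.edge}, fun x => by cases x <;> simp⟩

/-- The places in the input word. -/
inductive Place where
  | skip
  | flag (second : Bool)
  | num (i : Item)
  | den (i : Item)
  deriving Fintype

/-- The finite control. -/
structure Ctl where
  place : Place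
  av₁ : Bool
  av₂ : Bool
  pos : Bool
  ea : Bool
  eb : Bool
  deriving Fintype

/-- Whether the current agent is to choose the second product. -/
def Ctl.go (q : Ctl) : Bool := !q.av₁ || (q.av₂ && q.pos)

/-- What to do upon an input symbol. -/
def dispatch (q : Ctl) : Option Sym → Ctl × NumCmd × AgentCmd
  | none => ({q with place := .skip}, .nop, .commit q.go .clear)
  | some .agent => ({q with place := .flag false}, .reset,
      .commit q.go (match q.place with | .skip => .set | _ => .shift))
  | some (.bit b) => match q.place with
    | .skip => (q, .nop, .nop)
    | .flag false => ({q with place := .num .fst, av₁ := b, ea := true, eb := false}, .nop, .nop)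
    | .flag true => ({q with place := .num .snd, av₂ := b, ea := false, eb := true}, .nop, .nop)
    | .num _ => (q, .mulNum (q.ea && b) (q.eb && b), .nop)
    | .den _ => (q, .mulDen b, .nop)
  | some .slash => match q.place with
    | .num i => ({q with place := .den i}, .nop, .nop)
    | _ => (q, .nop, .nop)
  | some .noEdge => match q.place with
    | .num _ => (q, .nop, .point .shift)
    | _ => (q, .nop, .nop)
  | some .endNum => match q.place with
    | .den .fst => ({q with place := .flag true}, .next, .nop)
    | .den .snd => ({q with place := .num .edge}, .next, .point .set)
    | .den .edge => ({q with place := .num .edge}, .next, .point .shift)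
    | _ => (q, .nop, .nop)

/-- The program that finds a Nash equilibrium. Product `1` stands for `true`. -/
def program : SweepProgram Sym Ctl (Ctl × NumState × AgentState) (NumCell × AgentCell)
    (Fin 2) where
  q₀ := ⟨.skip, true, false, false, false, false⟩
  c₀ := (⟨false, false, false, false, false, false, false⟩, ⟨false, false, false, false⟩)
  start a q :=
    let r := dispatch q a
    (r.1, .start r.2.1 r.1.pos, .start r.2.2 r.1.ea r.1.eb)
  act w c :=
    let r := numAct w.2.1 c.1
    let t := agentAct w.2.2 c.2
    ((w.1, r.1, t.1), (r.2, t.2))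
  fin w := {w.1 with pos := w.2.1.pos, ea := w.2.2.ea, eb := w.2.2.eb}
  out c := if c.2.live then some (if c.2.s then 1 else 0) else none

/-- The data that a configuration of the program represents. -/
structure State (n : ℕ) where
  ctl : Ctl
  regs : Regs (ZMod (2 ^ n))
  agents : Agents

/-- The effect of an input symbol. -/
def State.step {n : ℕ} (x : State n) (a : Option Sym) : State n :=
  let r := dispatch x.ctl a
  let e := r.2.2.fetch n x.agents (r.1.ea, r.1.eb)
  { ctl := {r.1 with
      pos := match r.2.1 with
        | .next => decide (x.regs.b'.val < x.regs.a'.val)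
        | _ => r.1.pos
      ea := e.1
      eb := e.2}
    regs := r.2.1.exec x.regs
    agents := r.2.2.exec x.agents }

/-- Representation of the data by cells. -/
structure Represents (n : ℕ) (c : Ctl × List (NumCell × AgentCell)) (x : State n) : Prop where
  ctl : c.1 = x.ctl
  length : c.2.length = n
  regs : _root_.regs n (c.2.map Prod.fst) = x.regs
  agents : c.2.map Prod.snd = (List.range n).map x.agents.cell

/-- The transducers of registers and agents do not interact during a pass, so each can be analysed
separately. -/
theorem sweep_program (w : Ctl × NumState × AgentState) (l : List (NumCell × AgentCell)) :
    (sweep program.act w l).1 = (w.1, (sweep numAct w.2.1 (l.map Prod.fst)).1,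
      (sweep agentAct w.2.2 (l.map Prod.snd)).1) ∧
    (sweep program.act w l).2.map Prod.fst = (sweep numAct w.2.1 (l.map Prod.fst)).2 ∧
    (sweep program.act w l).2.map Prod.snd = (sweep agentAct w.2.2 (l.map Prod.snd)).2 := by
  induction l generalizing w with
  | nil => exact ⟨rfl, rfl, rfl⟩
  | cons c l ih =>
    obtain ⟨h₁, h₂, h₃⟩ := ih (program.act w c).1
    exact ⟨h₁, congrArg (_ :: ·) h₂, congrArg (_ :: ·) h₃⟩

/-- This simulation allows the program to be studied through `State.step` alone, without cells. -/
theorem Represents.symbol {n : ℕ} {c : Ctl × List (NumCell × AgentCell)} {x : State n}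
    (h : Represents n c x) (a : Option Sym) :
    Represents n (program.symbol c a) (x.step a) := by
  obtain ⟨h₁, h₂, h₃⟩ := sweep_program (program.start a c.1) c.2
  have hl : (c.2.map Prod.fst).length = n := by simpa using h.length
  obtain ⟨g₁, g₂⟩ := agents_sweep x.agents (dispatch c.1 a).2.2 (dispatch c.1 a).1.ea
    (dispatch c.1 a).1.eb n
  rw [← h.agents] at g₁ g₂
  have g₃ := regs_sweep (dispatch c.1 a).2.1 (dispatch c.1 a).1.pos _ hl
  have g₄ := pos_sweep (dispatch c.1 a).2.1 (dispatch c.1 a).1.pos _ hl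
  have g₅ := congrArg Prod.fst g₁
  have g₆ := congrArg Prod.snd g₁
  rw [h.regs] at g₃ g₄
  refine ⟨?_, by simp [h.length], ?_, ?_⟩
  · simp only [SweepProgram.symbol, h₁]
    simp only [program, State.step, ← h.ctl]
    congr 1
  · simp only [SweepProgram.symbol, h₂]
    simp only [State.step, ← h.ctl]
    exact g₃
  · simp only [SweepProgram.symbol, h₃]
    simp only [State.step, ← h.ctl]
    exact g₂

theorem Represents.foldl {n : ℕ} {c : Ctl × List (NumCell × AgentCell)} {x : State n}
    (h : Represents n c x) (l : List (Option Sym)) :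
    Represents n (l.foldl program.symbol c) (l.foldl State.step x) := by
  induction l generalizing c x with
  | nil => exact h
  | cons a l ih => exact ih (h.symbol a)

end SocialNetworkGame

namespace SocialNetworkGame

/-! ### Equilibria as fixed points of a monotone operator -/

section Equilibrium

variable {K : Type*} [Field K] [LinearOrder K] {V : Type*} [Fintype V] [DecidableEq V]

/-- The weight of the edges into `v`, from other agents, whose origins satisfy `p`. -/
def support (G : SocialNetworkGame K V 2) (p : V → Bool) (v : V) : K :=
  ∑ i, if (i, v) ∈ G.E ∧ i ≠ v ∧ p i then G.W (i, v) else 0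

/-- Whether `v` has to choose the second product, or can and strictly prefers to, when `T` is the
set of the agents that choose it. -/
def wants (G : SocialNetworkGame K V 2) (T : V → Bool) (v : V) : Bool :=
  !decide (0 ∈ G.P v) || (decide (1 ∈ G.P v) &&
    decide (G.θ v 1 + G.support (fun i => !T i) v < G.θ v 0 + G.support T v))

/-- The joint strategy in which the agents in `T` choose the second product. -/
def strategy (T : V → Bool) (v : V) : Fin 2 := if T v then 1 else 0

/-- A loop at `v` supports whatever `v` chooses. Split off, it cancels when two choices of `v` are
compared. -/
theorem sum_weight_update (G : SocialNetworkGame K V 2) (s : V → Fin 2) (v : V) (t : Fin 2) :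
    ∑ i ∈ (G.nbhd v).filter (fun i => Function.update s v t i = Function.update s v t v),
      G.W (i, v) = (if (v, v) ∈ G.E then G.W (v, v) else 0) +
        G.support (fun i => decide (s i = t)) v := by
  have h : (if (v, v) ∈ G.E then G.W (v, v) else 0) =
      ∑ i, if i = v then (if (v, v) ∈ G.E then G.W (v, v) else 0) else 0 := by simp
  rw [h, nbhd, Finset.filter_filter, Finset.sum_filter, support, ← Finset.sum_add_distrib]
  refine Finset.sum_congr rfl fun i _ => ?_
  by_cases hi : i = v
  · subst hi; simp
  · simp [hi]

variable [IsStrictOrderedRing K]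

theorem support_mono (G : SocialNetworkGame K V 2) (v : V) : Monotone fun p => G.support p v := by
  intro p q h
  refine Finset.sum_le_sum fun i _ => ?_
  by_cases hE : (i, v) ∈ G.E
  · have := (G.W_mem _ hE).1.le
    have hi := h i
    by_cases hp : p i = true
    · have hq : q i = true := by revert hi; rw [hp]; cases q i <;> simp
      simp [hp, hq]
    · rw [if_neg (by simp [hp])]
      split_ifs <;> simp [this]
  · simp [hE]

/-- This is where two products matter: an agent that joins `T` leaves the supporters of the only
other product, so both sides of the comparison move in the same direction. -/
theorem wants_mono (G : SocialNetworkGame K V 2) : Monotone G.wants := by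
  intro T U h v
  have h₁ := G.support_mono v h
  have h₂ : G.support (fun i => !U i) v ≤ G.support (fun i => !T i) v :=
    G.support_mono v fun i => by
      have := h i
      revert this
      cases T i <;> cases U i <;> simp
  simp only [wants] at h₁ ⊢
  by_cases h₃ : G.θ v 1 + G.support (fun i => !T i) v < G.θ v 0 + G.support T v
  · have h₄ : G.θ v 1 + G.support (fun i => !U i) v < G.θ v 0 + G.support U v := by linarith
    simp [h₃, h₄]
  · simp only [h₃, decide_false, Bool.and_false, Bool.or_false]
    cases decide (0 ∈ G.P v) <;> simp

/-- Utility increases with support minus threshold, which is why the thresholds appear crosswise in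
`wants`. Failure of the strict inequality is the weak one that agents outside `T` need. -/
theorem isNash_strategy (G : SocialNetworkGame K V 2) {T : V → Bool} (h : G.wants T = T) :
    G.IsNash (strategy T) := by
  have h₀ (v) : T v = false → 0 ∈ G.P v ∧ (1 ∈ G.P v →
      G.θ v 0 + G.support T v ≤ G.θ v 1 + G.support (fun i => !T i) v) := by
    intro hv
    have := congrFun h v
    rw [hv] at this
    simpa [wants] using this
  have h₁ (v) : T v = true → 1 ∈ G.P v ∧ (0 ∈ G.P v →
      G.θ v 1 + G.support (fun i => !T i) v ≤ G.θ v 0 + G.support T v) := by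
    intro hv
    have := congrFun h v
    rw [hv] at this
    simp only [wants, Bool.or_eq_true, Bool.not_eq_true', decide_eq_false_iff_not,
      Bool.and_eq_true, decide_eq_true_eq] at this
    rcases this with h' | h'
    · obtain ⟨t, ht⟩ := G.P_nonempty v
      refine ⟨?_, fun h => absurd h h'⟩
      fin_cases t
      · exact absurd ht h'
      · exact ht
    · exact ⟨h'.1, fun _ => h'.2.le⟩
  have e₀ : (fun i => decide (strategy T i = 0)) = fun i => !T i := by
    funext i; cases hi : T i <;> simp [strategy, hi]
  have e₁ : (fun i => decide (strategy T i = 1)) = T := by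
    funext i; cases hi : T i <;> simp [strategy, hi]
  refine ⟨fun v => ?_, fun v t ht => ?_⟩
  · cases hv : T v
    · simpa [strategy, hv] using (h₀ v hv).1
    · simpa [strategy, hv] using (h₁ v hv).1
  · conv_rhs => rw [← Function.update_eq_self v (strategy T)]
    unfold utility
    split_ifs with hN
    · exact le_rfl
    · have hc : (0 : K) ≤ 1 / (2 * (G.nbhd v).card) := by positivity
      refine add_le_add_right (mul_le_mul_of_nonneg_left ?_ hc) _
      rw [sum_weight_update, sum_weight_update, Function.update_self, Function.update_self]
      cases hv : T v
      · have hs : strategy T v = 0 := by simp [strategy, hv]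
        rw [hs, e₀]
        fin_cases t
        · exact (congrArg (fun p => _ + G.support p v - _) e₀).le
        · have := (h₀ v hv).2 ht
          have e := congrArg (fun p => G.support p v) e₁
          simp only [Fin.mk_one, Fin.isValue] at e ⊢
          rw [e]
          linarith
      · have hs : strategy T v = 1 := by simp [strategy, hv]
        rw [hs, e₁]
        fin_cases t
        · have := (h₁ v hv).2 ht
          have e := congrArg (fun p => G.support p v) e₀
          simp only [Fin.zero_eta, Fin.isValue] at e ⊢
          rw [e]
          linarith
        · exact (congrArg (fun p => _ + G.support p v - _) e₁).le

/-- Knaster–Tarski in the complete lattice `V → Bool`. -/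
theorem exists_isNash (G : SocialNetworkGame K V 2) : ∃ s : V → Fin 2, G.IsNash s :=
  ⟨_, G.isNash_strategy (OrderHom.map_lfp ⟨G.wants, G.wants_mono⟩)⟩

end Equilibrium

/-! ### Reaching a fixed point by rounds of joining -/

section Rounds

variable {K : Type*} [Field K] [LinearOrder K] {V : Type*} [Fintype V] [DecidableEq V]

/-- Agent `v` joins the agents that choose the second product if it wants to. -/
def join (G : SocialNetworkGame K V 2) (T : V → Bool) (v : V) : V → Bool :=
  fun i => T i || (decide (i = v) && G.wants T v)

/-- The agents of a list are asked in turn. -/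
def ask (G : SocialNetworkGame K V 2) (l : List V) (T : V → Bool) : V → Bool :=
  l.foldl G.join T

theorem le_join (G : SocialNetworkGame K V 2) (T : V → Bool) (v : V) : T ≤ G.join T v := by
  intro i
  simp only [join]
  cases T i <;> simp

theorem le_ask (G : SocialNetworkGame K V 2) (l : List V) (T : V → Bool) : T ≤ G.ask l T := by
  induction l generalizing T with
  | nil => exact le_rfl
  | cons v l ih => exact (G.le_join T v).trans (ih _)

/-- Sets only grow during a round, so if the round ends where it began, every agent of the list was
asked at `T` itself. -/
theorem wants_le_of_ask_eq (G : SocialNetworkGame K V 2) (l : List V) {T : V → Bool}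
    (h : G.ask l T = T) (v : V) (hv : v ∈ l) : G.wants T v ≤ T v := by
  induction l with
  | nil => simp at hv
  | cons w l ih =>
    have e : G.join T w = T :=
      le_antisymm ((G.le_ask l _).trans h.le) (G.le_join T w)
    rcases List.mem_cons.1 hv with rfl | hv
    · have := congrFun e v
      simp only [join] at this
      rw [← this]
      cases T v <;> simp
    · refine ih ?_ hv
      have : G.ask l (G.join T w) = T := h
      rwa [e] at this

/-- Either some agent joins in every round, or a round leaves everything unchanged. -/
theorem le_card_or_fixed (G : SocialNetworkGame K V 2) (l : List V) (T : V → Bool) (k : ℕ) :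
    k ≤ (Finset.univ.filter fun v => (G.ask l)^[k] T v = true).card ∨
      G.ask l ((G.ask l)^[k] T) = (G.ask l)^[k] T := by
  induction k with
  | zero => simp
  | succ k ih =>
    rw [Function.iterate_succ_apply']
    generalize (G.ask l)^[k] T = U at ih ⊢
    by_cases h : G.ask l U = U
    · rw [h, h]; exact .inr rfl
    · refine .inl (Nat.succ_le_of_lt ((ih.resolve_right h).trans_lt (Finset.card_lt_card ?_)))
      have hle := G.le_ask l U
      refine ⟨fun v hv => ?_, fun hs => h (le_antisymm (fun v => ?_) hle)⟩
      · have := hle v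
        simp only [Finset.mem_filter, Finset.mem_univ, true_and] at hv ⊢
        revert this
        rw [hv]
        cases G.ask l U v <;> simp
      · have := @hs v
        simp only [Finset.mem_filter, Finset.mem_univ, true_and] at this
        revert this
        cases G.ask l U v <;> cases U v <;> simp

variable [IsStrictOrderedRing K]

/-- An agent joins only if it wants to, and by monotonicity later arrivals cannot change its mind.
-/
theorem ask_le_wants (G : SocialNetworkGame K V 2) (l : List V) {T : V → Bool}
    (h : T ≤ G.wants T) : G.ask l T ≤ G.wants (G.ask l T) := by
  induction l generalizing T with
  | nil => exact h
  | cons v l ih =>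
    refine ih fun i => ?_
    have h₁ := G.wants_mono (G.le_join T v) i
    have h₂ := h i
    refine le_trans ?_ h₁
    simp only [join]
    by_cases hi : i = v
    · subst hi
      revert h₂
      cases T i <;> simp
    · simpa [hi] using h₂

theorem wants_iterate_ask (G : SocialNetworkGame K V 2) {l : List V} (hl : ∀ v, v ∈ l) {k : ℕ}
    (hk : Fintype.card V ≤ k) :
    G.wants ((G.ask l)^[k] fun _ => false) = (G.ask l)^[k] fun _ => false := by
  have h₁ : (G.ask l)^[k] (fun _ => false) ≤ G.wants ((G.ask l)^[k] fun _ => false) := by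
    clear hk
    induction k with
    | zero => intro v; simp
    | succ k ih => rw [Function.iterate_succ_apply']; exact G.ask_le_wants l ih
  have h₂ : G.ask l ((G.ask l)^[k] fun _ => false) = (G.ask l)^[k] fun _ => false := by
    -- If the count reaches `k`, all agents have joined and the set cannot grow any more.
    rcases G.le_card_or_fixed l (fun _ => false) k with h | h
    · have hu := Finset.eq_univ_of_card (Finset.univ.filter fun v => (G.ask l)^[k]
        (fun _ => false) v = true) (le_antisymm (Finset.card_le_univ _) (hk.trans h))
      have ht (v) : (G.ask l)^[k] (fun _ => false) v = true := by
        have := Finset.mem_univ v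
        rw [← hu] at this
        simpa using this
      refine le_antisymm (fun v => ?_) (G.le_ask l _)
      rw [ht v]
      exact Bool.le_true _
    · exact h
  exact le_antisymm (fun v => G.wants_le_of_ask_eq l h₂ v (hl v)) h₁

end Rounds

end SocialNetworkGame

/-! ### Reading a rational number -/

namespace SocialNetworkGame

theorem binVal_encodeNat (m : ℕ) : binVal (Computability.encodeNat m) = m := by
  have h (p : PosNum) : binVal (Computability.encodePosNum p) = (p : ℕ) := by
    induction p with
    | one => simp [Computability.encodePosNum, binVal]
    | bit0 p ih => simp [Computability.encodePosNum, binVal, ih]; ring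
    | bit1 p ih => simp [Computability.encodePosNum, binVal, ih]; ring
  have e : binVal (Computability.encodeNum (m : Num)) = ((m : Num) : ℕ) := by
    cases (m : Num) with
    | zero => rfl
    | pos p => exact h p
  rw [Computability.encodeNat, e, Num.to_of_nat]

theorem lt_two_pow_length_encodeNum (m : ℕ) : m < 2 ^ (encodeNum m).length := by
  conv_lhs => rw [← binVal_encodeNat m]
  simpa [encodeNum] using binVal_lt (Computability.encodeNat m)

namespace State

variable {n : ℕ}

/-- The effect of a word. -/
def run (x : State n) (l : List Sym) : State n := (l.map some).foldl step x

@[simp] theorem run_nil (x : State n) : x.run [] = x := rfl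

@[simp] theorem run_cons (x : State n) (a : Sym) (l : List Sym) :
    x.run (a :: l) = (x.step (some a)).run l := rfl

@[simp] theorem run_append (x : State n) (l m : List Sym) :
    x.run (l ++ m) = (x.run l).run m := by
  simp [run]

/-- School multiplication: `x` doubles with each digit, so the multiples added up amount to `x`
times the number read. -/
theorem run_bits_num (x : State n) {i : Item} (h : x.ctl.place = .num i) (l : List Bool) :
    x.run (l.map .bit) = {x with regs := {x.regs with
      a' := x.regs.a' + x.regs.x * binVal l * x.ctl.ea.toNat
      b' := x.regs.b' + x.regs.x * binVal l * x.ctl.eb.toNat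
      x := 2 ^ l.length * x.regs.x}} := by
  induction l generalizing x with
  | nil => simp [binVal]
  | cons b l ih =>
    have e : x.step (some (.bit b)) = {x with regs := {x.regs with
        a' := x.regs.a' + x.regs.x * b.toNat * x.ctl.ea.toNat
        b' := x.regs.b' + x.regs.x * b.toNat * x.ctl.eb.toNat
        x := 2 * x.regs.x}} := by
      obtain ⟨⟨p, v₁, v₂, s, ea, eb⟩, r, A⟩ := x
      obtain rfl : p = .num i := h
      cases b <;> cases ea <;> cases eb <;>
        simp [step, dispatch, NumCmd.exec, AgentCmd.fetch, AgentCmd.exec]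
    rw [List.map_cons, run_cons, e]
    refine (ih _ ?_).trans ?_
    · exact h
    simp only [State.mk.injEq, Regs.mk.injEq, true_and, and_true, binVal, List.length_cons]
    push_cast
    refine ⟨?_, ?_, ?_⟩ <;> ring

theorem run_bits_den (x : State n) {i : Item} (h : x.ctl.place = .den i) (l : List Bool) :
    x.run (l.map .bit) = {x with regs := {x.regs with
      a' := x.regs.a' + x.regs.a * binVal l
      b' := x.regs.b' + x.regs.b * binVal l
      d' := x.regs.d' + x.regs.d * binVal l
      a := 2 ^ l.length * x.regs.a
      b := 2 ^ l.length * x.regs.b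
      d := 2 ^ l.length * x.regs.d}} := by
  induction l generalizing x with
  | nil => simp [binVal]
  | cons b l ih =>
    have e : x.step (some (.bit b)) = {x with regs := {x.regs with
        a' := x.regs.a' + x.regs.a * b.toNat
        b' := x.regs.b' + x.regs.b * b.toNat
        d' := x.regs.d' + x.regs.d * b.toNat
        a := 2 * x.regs.a
        b := 2 * x.regs.b
        d := 2 * x.regs.d}} := by
      obtain ⟨⟨p, v₁, v₂, s, ea, eb⟩, r, A⟩ := x
      obtain rfl : p = .den i := h
      rfl
    rw [List.map_cons, run_cons, e]
    refine (ih _ ?_).trans ?_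
    · exact h
    simp only [State.mk.injEq, Regs.mk.injEq, true_and, and_true, binVal, List.length_cons]
    push_cast
    refine ⟨?_, ?_, ?_, ?_, ?_, ?_⟩ <;> ring

end State

/-- The place after a number. -/
def Item.next : Item → Place
  | .fst => .flag true
  | _ => .num .edge

/-- The move of the edge mark after a number. -/
def Item.cmd : Item → AgentCmd
  | .fst => .nop
  | .snd => .point .set
  | .edge => .point .shift

namespace State

variable {n : ℕ}

theorem step_endNum (x : State n) {i : Item} (h : x.ctl.place = .den i) :
    x.step (some .endNum) =
      ⟨{x.ctl with
        place := i.next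
        pos := decide (x.regs.b'.val < x.regs.a'.val)
        ea := (i.cmd.fetch n x.agents (x.ctl.ea, x.ctl.eb)).1
        eb := (i.cmd.fetch n x.agents (x.ctl.ea, x.ctl.eb)).2},
        ⟨x.regs.a', 0, x.regs.b', 0, x.regs.d', 0, x.regs.d'⟩, i.cmd.exec x.agents⟩ := by
  cases i <;> simp only [step, dispatch, h] <;> rfl

/-- The registers hold the fractions `u` and `t` with a common denominator, and with entries that
are bounded in terms of the length `k` of the word read. -/
def Holds (x : State n) (k : ℕ) (u t : ℚ) : Prop :=
  ∃ A B D : ℕ, x.regs = ⟨A, 0, B, 0, D, 0, D⟩ ∧ 0 < D ∧ A + D ≤ 2 ^ k ∧ B + D ≤ 2 ^ k ∧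
    (A : ℚ) = D * u ∧ (B : ℚ) = D * t

/-- With `r = p / q`, the update is `A / D + p / q = (A * q + D * p) / (D * q)`: the product with
`p` is added while the numerator is read, the multiplication by `q` follows, and the end mark
compares the new numerators. -/
theorem run_encodeRat (x : State n) {i : Item} (h : x.ctl.place = .num i) {k : ℕ} {u t r : ℚ}
    (hx : x.Holds k u t) (hr : r ∈ Set.Ioc 0 1) (hk : k + (encodeRat r).length ≤ n) :
    (x.run (encodeRat r)).ctl = {x.ctl with
        place := i.next
        pos := decide (t + r * x.ctl.eb.toNat < u + r * x.ctl.ea.toNat)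
        ea := (i.cmd.fetch n x.agents (x.ctl.ea, x.ctl.eb)).1
        eb := (i.cmd.fetch n x.agents (x.ctl.ea, x.ctl.eb)).2} ∧
      (x.run (encodeRat r)).agents = i.cmd.exec x.agents ∧
      (x.run (encodeRat r)).Holds (k + (encodeRat r).length)
        (u + r * x.ctl.ea.toNat) (t + r * x.ctl.eb.toNat) := by
  obtain ⟨A, B, D, hreg, hD, hA, hB, hu, ht⟩ := hx
  obtain ⟨p, hp⟩ : ∃ p, p = r.num.natAbs := ⟨_, rfl⟩
  obtain ⟨q, hq⟩ : ∃ q, q = r.den := ⟨_, rfl⟩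
  have hq0 : 0 < q := hq ▸ r.den_pos
  have hpr : (p : ℚ) = q * r := by
    have h1 : ((r.num.natAbs : ℤ) : ℚ) = r.num := by
      rw [Int.natAbs_of_nonneg (Rat.num_nonneg.2 hr.1.le)]
    rw [hp, hq, mul_comm, Rat.mul_den_eq_num, ← h1, Int.cast_natCast]
  have hpq : p ≤ q := by
    have : (p : ℚ) ≤ q := by
      rw [hpr]
      exact mul_le_of_le_one_right (by positivity) hr.2
    exact_mod_cast this
  have hlen : (encodeRat r).length = (encodeNum p).length + (encodeNum q).length + 2 := by
    simp [encodeRat, hp, hq]; omega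
  have hql := lt_two_pow_length_encodeNum q
  obtain ⟨j, hj⟩ : ∃ j, j = k + (encodeRat r).length := ⟨_, rfl⟩
  rw [← hj] at hk ⊢
  -- Since `p ≤ q`, the left side is at most `2 * ((C + D) * q)`. The digits of `q` pay for the
  -- factor `q`, and the separator or the end mark pays for the `2`.
  have hbound (C : ℕ) (e : Bool) (hC : C + D ≤ 2 ^ k) :
      (C * q + D * p * e.toNat) + D * q ≤ 2 ^ j := by
    have h1 : D * p * e.toNat ≤ D * q := by
      calc D * p * e.toNat ≤ D * p * 1 := Nat.mul_le_mul_left _ (Bool.toNat_le e)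
        _ ≤ D * q := by rw [mul_one]; exact Nat.mul_le_mul_left _ hpq
    have h3 : D * q ≤ (C + D) * q := Nat.mul_le_mul_right _ (by omega)
    have h2 : (C + D) * q ≤ 2 ^ k * 2 ^ (encodeNum q).length := Nat.mul_le_mul hC hql.le
    calc (C * q + D * p * e.toNat) + D * q ≤ 2 * ((C + D) * q) := by nlinarith
      _ ≤ 2 * (2 ^ k * 2 ^ (encodeNum q).length) := Nat.mul_le_mul_left _ h2
      _ = 2 ^ (k + (encodeNum q).length + 1) := by ring
      _ ≤ 2 ^ j := Nat.pow_le_pow_right (by norm_num) (by omega)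
  -- As `D * q` is positive, the bound is strict for the numerator, which therefore equals its
  -- residue.
  have hval (C : ℕ) (e : Bool) (hC : C + D ≤ 2 ^ k) :
      ((C * q + D * p * e.toNat : ℕ) : ZMod (2 ^ n)).val = C * q + D * p * e.toNat := by
    rw [ZMod.val_natCast, Nat.mod_eq_of_lt]
    have h1 := hbound C e hC
    have h2 : 0 < D * q := Nat.mul_pos hD hq0
    have h3 : 2 ^ j ≤ 2 ^ n := Nat.pow_le_pow_right (by norm_num) hk
    omega
  have hfrac (C : ℕ) (w : ℚ) (e : Bool) (hw : (C : ℚ) = D * w) :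
      ((C * q + D * p * e.toNat : ℕ) : ℚ) = (D * q : ℕ) * (w + r * e.toNat) := by
    push_cast
    rw [hw, hpr]
    ring
  have hrun : x.run (encodeRat r) =
      ⟨{x.ctl with
        place := i.next
        pos := decide (((B * q + D * p * x.ctl.eb.toNat : ℕ) : ZMod (2 ^ n)).val <
          ((A * q + D * p * x.ctl.ea.toNat : ℕ) : ZMod (2 ^ n)).val)
        ea := (i.cmd.fetch n x.agents (x.ctl.ea, x.ctl.eb)).1
        eb := (i.cmd.fetch n x.agents (x.ctl.ea, x.ctl.eb)).2},
        ⟨(A * q + D * p * x.ctl.ea.toNat : ℕ), 0, (B * q + D * p * x.ctl.eb.toNat : ℕ), 0,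
          (D * q : ℕ), 0, (D * q : ℕ)⟩, i.cmd.exec x.agents⟩ := by
    have hs (y : State n) (hy : y.ctl.place = .num i) :
        y.step (some .slash) = {y with ctl := {y.ctl with place := .den i}} := by
      simp only [step, dispatch, hy]
      rfl
    rw [encodeRat, encodeNum, encodeNum, run_append, run_bits_num x h, run_cons]
    refine (congrArg (fun y => run y _) (hs _ ?_)).trans ?_
    · exact h
    rw [run_append]
    refine (congrArg (fun y => run y _) (run_bits_den (i := i) _ rfl _)).trans ?_
    refine (step_endNum (i := i) _ rfl).trans ?_
    simp only [binVal_encodeNat, ← hp, ← hq, hreg]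
    have e (C : ℕ) (e : Bool) : (0 + (D : ZMod (2 ^ n)) * p * e.toNat + C * q) =
        ((C * q + D * p * e.toNat : ℕ) : ZMod (2 ^ n)) := by
      push_cast; ring
    rw [e, e]
    simp
  rw [hrun]
  refine ⟨?_, rfl, _, _, _, rfl, Nat.mul_pos hD hq0, hbound A _ hA, hbound B _ hB,
    hfrac A u _ hu, hfrac B t _ ht⟩
  simp only [hval A _ hA, hval B _ hB, Ctl.mk.injEq, true_and, and_true]
  rw [decide_eq_decide, ← Nat.cast_lt (α := ℚ), hfrac A u _ hu, hfrac B t _ ht]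
  exact mul_lt_mul_iff_right₀ (by exact_mod_cast Nat.mul_pos hD hq0)

end State

end SocialNetworkGame

/-! ### Reading the block of an agent -/

namespace SocialNetworkGame

/-- The column of the weighted adjacency matrix that belongs to `v`, restricted to the rows `l`. -/
def encodeEdges {m : ℕ} (G : SocialNetworkGame ℚ (Fin m) 2) (v : Fin m) (l : List (Fin m)) :
    List Sym :=
  l.flatMap fun i => if (i, v) ∈ G.E then encodeRat (G.W (i, v)) else [Sym.noEdge]

namespace State

variable {n m : ℕ}

/-- The choices when the decision of the current agent is taken into account. -/
def choice (x : State n) (j : ℕ) : Bool :=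
  x.agents.S j || (decide (x.agents.cur = j + 1) && x.ctl.go)

theorem step_noEdge (x : State n) {i : Item} (h : x.ctl.place = .num i) :
    x.step (some .noEdge) =
      ⟨{x.ctl with
        ea := (AgentCmd.fetch n x.agents (x.ctl.ea, x.ctl.eb) (.point .shift)).1
        eb := (AgentCmd.fetch n x.agents (x.ctl.ea, x.ctl.eb) (.point .shift)).2},
        x.regs, AgentCmd.exec x.agents (.point .shift)⟩ := by
  simp only [step, dispatch, h]
  rfl

theorem Holds.mono {x : State n} {k l : ℕ} {u t : ℚ} (h : x.Holds k u t) (hkl : k ≤ l) :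
    x.Holds l u t := by
  obtain ⟨A, B, D, hr, hD, hA, hB, hu, ht⟩ := h
  have := Nat.pow_le_pow_right (n := 2) (by norm_num) hkl
  exact ⟨A, B, D, hr, hD, hA.trans this, hB.trans this, hu, ht⟩

/-- Invariant: before row `i` the edge mark is at place `i + 1` and the flags for agent `i` have
already been fetched. After the last row the mark moves to place `m + 1`, which exists because `m <
n`. The hypothesis on `pos` is needed since a missing edge triggers no comparison. -/
theorem run_encodeEdges (G : SocialNetworkGame ℚ (Fin m) 2) (v : Fin m) (hm : m < n)
    (l : List (Fin m)) (i : ℕ) (hl : l.map Fin.val = List.range' i l.length) (x : State n)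
    (hplace : x.ctl.place = .num .edge) (hptr : x.agents.ptr = i + 1) (hcur : x.agents.cur = v + 1)
    (hea : x.ctl.ea = (x.agents.S i && !decide (x.agents.cur = i + 1)))
    (heb : x.ctl.eb = (!x.agents.S i && !decide (x.agents.cur = i + 1)))
    {k : ℕ} {u t : ℚ} (hpos : x.ctl.pos = decide (t < u)) (hx : x.Holds k u t)
    (hk : k + (encodeEdges G v l).length ≤ n) :
    (x.run (encodeEdges G v l)).ctl.place = .num .edge ∧
    (x.run (encodeEdges G v l)).ctl.av₁ = x.ctl.av₁ ∧
    (x.run (encodeEdges G v l)).ctl.av₂ = x.ctl.av₂ ∧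
    (x.run (encodeEdges G v l)).ctl.pos = decide
      (t + (l.map fun j => if (j, v) ∈ G.E ∧ j ≠ v ∧ (!x.agents.S j) = true
          then G.W (j, v) else 0).sum <
        u + (l.map fun j => if (j, v) ∈ G.E ∧ j ≠ v ∧ x.agents.S j = true
          then G.W (j, v) else 0).sum) ∧
    (x.run (encodeEdges G v l)).agents.S = x.agents.S ∧
    (x.run (encodeEdges G v l)).agents.live = x.agents.live ∧
    (x.run (encodeEdges G v l)).agents.cur = x.agents.cur := by
  induction l generalizing i x k u t with
  | nil => simpa [encodeEdges] using ⟨hplace, hpos⟩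
  | cons j l ih =>
    rw [List.map_cons, List.length_cons, List.range'_succ, List.cons.injEq] at hl
    obtain ⟨hj, hl⟩ := hl
    have hjm := j.isLt
    obtain ⟨w, hw⟩ : ∃ w, w = if (j, v) ∈ G.E then encodeRat (G.W (j, v)) else [Sym.noEdge] :=
      ⟨_, rfl⟩
    have he : encodeEdges G v (j :: l) = w ++ encodeEdges G v l := by
      rw [hw]; rfl
    rw [he, List.length_append] at hk
    have hmv : MarkMove.apply x.agents.ptr .shift = i + 1 + 1 := by
      simp [MarkMove.apply, hptr]
    have hfetch : AgentCmd.fetch n x.agents (x.ctl.ea, x.ctl.eb) (.point .shift) =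
        (x.agents.S (i + 1) && !decide (x.agents.cur = i + 1 + 1),
          !x.agents.S (i + 1) && !decide (x.agents.cur = i + 1 + 1)) := by
      rw [AgentCmd.fetch, hmv, if_pos ⟨by omega, by omega⟩]
      rfl
    -- The row of the current agent itself is recognised by its mark, so that loops are ignored.
    have hcurj : x.agents.cur = j + 1 ↔ j = v := by
      rw [hcur, Fin.ext_iff]; omega
    have hdec : decide (x.agents.cur = j + 1) = decide (j = v) := decide_eq_decide.2 hcurj
    obtain ⟨a, ha⟩ : ∃ a, a = if (j, v) ∈ G.E ∧ j ≠ v ∧ x.agents.S j = true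
      then G.W (j, v) else 0 := ⟨_, rfl⟩
    obtain ⟨b, hb⟩ : ∃ b, b = if (j, v) ∈ G.E ∧ j ≠ v ∧ (!x.agents.S j) = true
      then G.W (j, v) else 0 := ⟨_, rfl⟩
    have key : (x.run w).ctl = {x.ctl with
          pos := decide (t + b < u + a)
          ea := x.agents.S (i + 1) && !decide (x.agents.cur = i + 1 + 1)
          eb := !x.agents.S (i + 1) && !decide (x.agents.cur = i + 1 + 1)} ∧
        (x.run w).agents = {x.agents with ptr := i + 1 + 1} ∧
        (x.run w).Holds (k + w.length) (u + a) (t + b) := by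
      by_cases hE : (j, v) ∈ G.E
      · rw [if_pos hE] at hw
        subst hw
        have ha' : G.W (j, v) * x.ctl.ea.toNat = a := by
          rw [ha, hea, ← hj, hdec]
          by_cases h₁ : j = v <;> cases h₂ : x.agents.S j <;> simp [hE, h₁]
        have hb' : G.W (j, v) * x.ctl.eb.toNat = b := by
          rw [hb, heb, ← hj, hdec]
          by_cases h₁ : j = v <;> cases h₂ : x.agents.S j <;> simp [hE, h₁]
        obtain ⟨h₁, h₂, h₃⟩ := x.run_encodeRat hplace hx (G.W_mem _ hE) (by omega)
        rw [ha', hb'] at h₁ h₃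
        simp only [Item.cmd, Item.next, hfetch] at h₁ h₂
        refine ⟨?_, ?_, h₃⟩
        · rw [h₁, ← hplace]
        · rw [h₂, AgentCmd.exec, hmv]
      · rw [if_neg hE] at hw
        subst hw
        have ha' : a = 0 := by rw [ha, if_neg (by simp [hE])]
        have hb' : b = 0 := by rw [hb, if_neg (by simp [hE])]
        rw [run_cons, run_nil, step_noEdge x hplace, hfetch, ha', hb', add_zero, add_zero, ← hpos]
        refine ⟨rfl, ?_, ?_⟩
        · rw [AgentCmd.exec, hmv]
        · exact hx.mono (by simp)
    obtain ⟨h₁, h₂, h₃⟩ := key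
    obtain ⟨g₁, g₂, g₃, g₄, g₅, g₆, g₇⟩ := ih (i + 1) hl (x.run w) (by rw [h₁, hplace])
      (by rw [h₂]) (by rw [h₂, hcur]) (by rw [h₁, h₂]) (by rw [h₁, h₂]) (by rw [h₁]) h₃ (by omega)
    rw [he, run_append]
    refine ⟨g₁, by rw [g₂, h₁], by rw [g₃, h₁], ?_, by rw [g₅, h₂], by rw [g₆, h₂], by rw [g₇, h₂]⟩
    have hS : (x.run w).agents.S = x.agents.S := by rw [h₂]
    rw [g₄, hS, List.map_cons, List.map_cons, List.sum_cons, List.sum_cons, ← ha, ← hb,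
      ← add_assoc, ← add_assoc]

/-- The decision on `v` stays pending until the next block or the end of the word; `choice` includes
it, which makes the effect of a block exactly one `join`. The thresholds of the two products go to
opposite fractions, and so do the edges from agents inside and outside the chosen set. -/
theorem run_encodeAgent (G : SocialNetworkGame ℚ (Fin m) 2) (v : Fin m) (hm : m < n)
    (x : State n) (hplace : x.ctl.place = .skip ↔ (v : ℕ) = 0) (hcur : x.agents.cur = v)
    (hn : (encodeAgent G v).length ≤ n) :
    (x.run (encodeAgent G v)).ctl.place = .num .edge ∧
    (x.run (encodeAgent G v)).agents.cur = v + 1 ∧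
    (∀ j, (x.run (encodeAgent G v)).agents.live j = (x.agents.live j || decide (j = v))) ∧
    ∀ j : Fin m, (x.run (encodeAgent G v)).choice j = G.join (fun i => x.choice i) v j := by
  have he : encodeAgent G v = .agent :: .bit (decide (0 ∈ G.P v)) :: (encodeRat (G.θ v 0) ++
      .bit (decide (1 ∈ G.P v)) :: (encodeRat (G.θ v 1) ++
        encodeEdges G v (List.finRange m))) := by
    simp [encodeAgent, encodeEdges, List.finRange_succ]
  have hlen : (encodeAgent G v).length = (encodeRat (G.θ v 0)).length +
      (encodeRat (G.θ v 1)).length + (encodeEdges G v (List.finRange m)).length + 3 := by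
    rw [he]; simp; omega
  obtain ⟨mv, hmv⟩ : ∃ mv : MarkMove,
      mv = match x.ctl.place with | .skip => .set | _ => .shift := ⟨_, rfl⟩
  have happly : mv.apply x.agents.cur = v + 1 := by
    rw [hcur]
    cases hp : x.ctl.place with
    | skip =>
      rw [hp] at hmv
      simp [hmv, MarkMove.apply, hplace.1 hp]
    | _ =>
      have hv : (v : ℕ) ≠ 0 := fun h => by simp [hplace.2 h] at hp
      rw [hp] at hmv
      simp [hmv, MarkMove.apply, hv]
  -- The opening mark commits the pending decision, so the recorded choices become `x.choice`.
  have h₁ : (x.step (some .agent)).step (some (.bit (decide (0 ∈ G.P v)))) =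
      ⟨{x.ctl with place := .num .fst, av₁ := decide (0 ∈ G.P v), ea := true, eb := false},
        ⟨0, 0, 0, 0, 1, 0, 1⟩,
        ⟨x.choice, fun j => x.agents.live j || decide (v + 1 = j + 1), v + 1, 0⟩⟩ := by
    rw [← happly, hmv]
    rfl
  obtain ⟨x₁, hx₁⟩ : ∃ y, y = (x.step (some .agent)).step (some (.bit (decide (0 ∈ G.P v)))) :=
    ⟨_, rfl⟩
  -- After the reset both fractions are `0 / 1`, and `0 + 1 ≤ 2 ^ 0`.
  have hold₁ : x₁.Holds 0 0 0 := ⟨0, 0, 1, by rw [hx₁, h₁]; simp, by simp, by simp, by simp,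
    by simp, by simp⟩
  obtain ⟨a₁, a₂, a₃⟩ := x₁.run_encodeRat (i := .fst) (by rw [hx₁, h₁]) hold₁ (G.θ_mem v 0)
    (by omega)
  obtain ⟨x₂, hx₂⟩ : ∃ y, y = (x₁.run (encodeRat (G.θ v 0))).step
    (some (.bit (decide (1 ∈ G.P v)))) := ⟨_, rfl⟩
  have h₂ : x₂ = ⟨{(x₁.run (encodeRat (G.θ v 0))).ctl with
      place := .num .snd, av₂ := decide (1 ∈ G.P v), ea := false, eb := true},
      (x₁.run (encodeRat (G.θ v 0))).regs, (x₁.run (encodeRat (G.θ v 0))).agents⟩ := by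
    rw [hx₂]
    simp only [step, dispatch, a₁, Item.next]
    rfl
  have hold₂ : x₂.Holds (0 + (encodeRat (G.θ v 0)).length) (G.θ v 0) 0 := by
    have := a₃
    rw [hx₁, h₁] at this
    rw [h₂, hx₁, h₁]
    simpa [Holds] using this
  obtain ⟨b₁, b₂, b₃⟩ := x₂.run_encodeRat (i := .snd) (by rw [h₂]) hold₂ (G.θ_mem v 1)
    (by omega)
  obtain ⟨x₃, hx₃⟩ : ∃ y, y = x₂.run (encodeRat (G.θ v 1)) := ⟨_, rfl⟩
  rw [← hx₃] at b₁ b₂ b₃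
  have hea : x₂.ctl.ea = false := by rw [h₂]
  have heb : x₂.ctl.eb = true := by rw [h₂]
  have hag : x₂.agents =
      ⟨x.choice, fun j => x.agents.live j || decide (v + 1 = j + 1), v + 1, 0⟩ := by
    rw [h₂]
    dsimp only
    rw [a₂, hx₁, h₁]
    rfl
  have hav : x₂.ctl.av₁ = decide (0 ∈ G.P v) ∧ x₂.ctl.av₂ = decide (1 ∈ G.P v) := by
    rw [h₂]
    refine ⟨?_, rfl⟩
    dsimp only
    rw [a₁, hx₁, h₁]
  rw [hea, heb] at b₁ b₃
  rw [hag] at b₁ b₂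
  -- The end of the second threshold places the edge mark on the first agent and fetches its flags.
  have hfetch : AgentCmd.fetch n ⟨x.choice, fun j => x.agents.live j || decide ((v : ℕ) + 1 = j + 1),
      v + 1, 0⟩ (false, true) (.point .set) = (x.choice 0 && !decide ((v : ℕ) + 1 = 0 + 1),
        !x.choice 0 && !decide ((v : ℕ) + 1 = 0 + 1)) := by
    rw [AgentCmd.fetch, MarkMove.apply, if_pos ⟨le_rfl, by omega⟩]
  simp only [Item.cmd, hfetch, AgentCmd.exec, MarkMove.apply, Item.next] at b₁ b₂
  simp only [Bool.toNat_false, Bool.toNat_true, Nat.cast_zero, Nat.cast_one, mul_zero, mul_one,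
    add_zero, zero_add] at b₁ b₃
  obtain ⟨c₁, c₂, c₃, c₄, c₅, c₆, c₇⟩ := run_encodeEdges G v hm (List.finRange m) 0
    (by simp [List.range_eq_range']) x₃ (by rw [b₁]) (by rw [b₂]) (by rw [b₂])
    (by rw [b₁, b₂]) (by rw [b₁, b₂]) (by rw [b₁]) b₃ (by omega)
  have hrun : x.run (encodeAgent G v) = x₃.run (encodeEdges G v (List.finRange m)) := by
    rw [he, run_cons, run_cons, run_append, run_cons, run_append, ← hx₁, ← hx₂, ← hx₃]
  rw [hrun]
  refine ⟨c₁, by rw [c₇, b₂], fun j => ?_, fun j => ?_⟩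
  · rw [c₆, b₂]
    dsimp only
    congr 2
    rw [eq_iff_iff]
    omega
  · have hgo : (x₃.run (encodeEdges G v (List.finRange m))).ctl.go =
        G.wants (fun i => x.choice i) v := by
      rw [Ctl.go, c₂, c₃, c₄, b₁, b₂, hav.1, hav.2, wants, support, support, Fin.sum_univ_def,
        Fin.sum_univ_def]
    rw [choice, hgo, c₅, c₇, b₂, join]
    dsimp only
    congr 3
    rw [eq_iff_iff, Fin.ext_iff]
    omega

/-- The machine is about to read the block of agent `v`; agents up to `k` have been seen. -/
structure Ready (x : State n) (v k : ℕ) (T : Fin m → Bool) : Prop where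
  place : x.ctl.place = .skip ↔ v = 0
  cur : x.agents.cur = v
  live : ∀ j, x.agents.live j = decide (j < k ∨ j < v)
  choice : ∀ j : Fin m, x.choice j = T j

theorem Ready.run {G : SocialNetworkGame ℚ (Fin m) 2} (hm : m < n)
    (hn : ∀ v, (encodeAgent G v).length ≤ n) {l : List (Fin m)} {v : ℕ}
    (hl : l.map Fin.val = List.range' v l.length) {x : State n} {k : ℕ} {T : Fin m → Bool}
    (h : x.Ready v k T) :
    (x.run (l.flatMap (encodeAgent G))).Ready (v + l.length) k (G.ask l T) := by
  induction l generalizing v x T with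
  | nil => exact h
  | cons w l ih =>
    rw [List.map_cons, List.length_cons, List.range'_succ, List.cons.injEq] at hl
    obtain ⟨rfl, hl⟩ := hl
    obtain ⟨h₁, h₂, h₃, h₄⟩ := run_encodeAgent G w hm x h.place h.cur (hn w)
    rw [List.flatMap_cons, run_append, List.length_cons, ← add_assoc, add_right_comm]
    refine ih hl ⟨by simp [h₁], h₂, fun j => ?_, fun j => ?_⟩
    · rw [h₃, h.live, ← Bool.decide_or]
      congr 1
      rw [eq_iff_iff]
      omega
    · rw [h₄]
      congr 1
      funext i
      exact h.choice i

/-- This passes over `c₀`, which has no influence on equilibria. -/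
theorem run_of_skip (x : State n) (h : x.ctl.place = .skip) (l : List Sym) (hl : .agent ∉ l) :
    x.run l = x := by
  induction l with
  | nil => rfl
  | cons a l ih =>
    rw [List.mem_cons, not_or] at hl
    have e : x.step (some a) = x := by
      obtain ⟨⟨p, v₁, v₂, s, ea, eb⟩, r, A⟩ := x
      obtain rfl : p = .skip := h
      cases a with
      | agent => exact absurd rfl hl.1
      | _ => rfl
    rw [run_cons, e, ih hl.2]

end State

/-! ### Reading the whole word, and the output -/

theorem length_encode {m : ℕ} (G : SocialNetworkGame ℚ (Fin m) 2) :
    (encode ⟨m, G⟩).length = (encodeRat G.c₀).length + ∑ v, (encodeAgent G v).length := by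
  rw [Fin.sum_univ_def, ← List.length_flatMap]
  exact List.length_append

/-- Every agent contributes a symbol and `c₀` at least one more. Hence there are enough rounds, and
a spare cell for the edge mark. -/
theorem card_lt_length_encode {m : ℕ} (G : SocialNetworkGame ℚ (Fin m) 2) :
    m < (encode ⟨m, G⟩).length := by
  have h₀ : 0 < (encodeRat G.c₀).length := by simp [encodeRat]
  have h₁ : m ≤ ∑ v, (encodeAgent G v).length := by
    calc m = ∑ v : Fin m, 1 := by simp
      _ ≤ _ := Finset.sum_le_sum fun v _ => by simp [encodeAgent]
  rw [length_encode]
  omega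

theorem length_encodeAgent_le {m : ℕ} (G : SocialNetworkGame ℚ (Fin m) 2) (v : Fin m) :
    (encodeAgent G v).length ≤ (encode ⟨m, G⟩).length := by
  have h : (encodeAgent G v).length ≤ ∑ v, (encodeAgent G v).length :=
    Finset.single_le_sum (f := fun v => (encodeAgent G v).length)
      (fun _ _ => Nat.zero_le _) (Finset.mem_univ v)
  rw [length_encode]
  omega

namespace State

variable {n m : ℕ}

/-- The end symbol commits the decision of the last agent, removes the marks and returns to the
initial place. -/
theorem Ready.round {G : SocialNetworkGame ℚ (Fin m) 2} (hG : (encode ⟨m, G⟩).length = n)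
    {x : State n} {k : ℕ} (hk : k ≤ m) {T : Fin m → Bool} (h : x.Ready 0 k T) :
    (((encode ⟨m, G⟩).map some ++ [none]).foldl step x).Ready 0 m
      (G.ask (List.finRange m) T) := by
  have hm : m < n := hG ▸ card_lt_length_encode G
  have hn (v) : (encodeAgent G v).length ≤ n := hG ▸ length_encodeAgent_le G v
  have hrun : ((encode ⟨m, G⟩).map some ++ [none]).foldl step x =
      (x.run ((List.finRange m).flatMap (encodeAgent G))).step none := by
    rw [List.foldl_append]
    change (x.run (encode ⟨m, G⟩)).step none = _
    rw [encode, run_append, run_of_skip x (h.place.2 rfl) _ (by simp [encodeRat, encodeNum])]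
  have hr := h.run hm hn (G := G) (l := List.finRange m) (by simp [List.range_eq_range'])
  rw [hrun]
  refine ⟨by simp [step, dispatch], rfl, fun j => ?_, fun j => ?_⟩
  · have : (x.run ((List.finRange m).flatMap (encodeAgent G))).agents.live j =
        decide (j < m ∨ j < 0) := by
      rw [hr.live, List.length_finRange]
      congr 1
      rw [eq_iff_iff]
      omega
    rw [← this]
    simp [step, dispatch, AgentCmd.exec, MarkMove.apply]
  · rw [← hr.choice j]
    simp [State.choice, step, dispatch, AgentCmd.exec, MarkMove.apply]

end State

instance : Inhabited Sym := ⟨.agent⟩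

/-- The equilibrium that the program finds. -/
def equilibrium (m : ℕ) (G : SocialNetworkGame ℚ (Fin m) 2) : Fin m → Fin 2 :=
  strategy ((G.ask (List.finRange m))^[(encode ⟨m, G⟩).length] fun _ => false)

theorem isNash_equilibrium (m : ℕ) (G : SocialNetworkGame ℚ (Fin m) 2) :
    G.IsNash (equilibrium m G) :=
  G.isNash_strategy (G.wants_iterate_ask List.mem_finRange
    (by simpa using (card_lt_length_encode G).le))

/-- The machine learns the number of agents only by marking cells as live during the first reading;
hence the case distinction on `k`. -/
theorem exists_represents_iterate (m : ℕ) (G : SocialNetworkGame ℚ (Fin m) 2) (k : ℕ) :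
    ∃ x : State (encode ⟨m, G⟩).length,
      Represents (encode ⟨m, G⟩).length ((program.round (encode ⟨m, G⟩))^[k]
        (program.q₀, List.replicate (encode ⟨m, G⟩).length program.c₀)) x ∧
      x.Ready 0 (if k = 0 then 0 else m) ((G.ask (List.finRange m))^[k] fun _ => false) := by
  induction k with
  | zero =>
    refine ⟨⟨program.q₀, _, ⟨fun _ => false, fun _ => false, 0, 0⟩⟩,
      ⟨rfl, by simp, rfl, ?_⟩, ⟨by simp [program], rfl, by simp, ?_⟩⟩
    · refine List.ext_getElem (by simp) fun i hi hi' => ?_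
      simp [Agents.cell, program]
    · simp [State.choice]
  | succ k ih =>
    obtain ⟨x, hx, hr⟩ := ih
    rw [Function.iterate_succ_apply', Function.iterate_succ_apply']
    exact ⟨_, hx.foldl _, hr.round rfl (by split_ifs <;> omega)⟩

theorem eval_program (m : ℕ) (G : SocialNetworkGame ℚ (Fin m) 2) :
    program.eval (encode ⟨m, G⟩) = List.ofFn (equilibrium m G) := by
  have hm := card_lt_length_encode G
  obtain ⟨x, hx, hr⟩ := exists_represents_iterate m G (encode ⟨m, G⟩).length
  rw [if_neg (by omega)] at hr
  have e : program.eval (encode ⟨m, G⟩) = ((List.range (encode ⟨m, G⟩).length).map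
      x.agents.cell).filterMap (fun c => if c.live then some (if c.s then 1 else 0) else none) := by
    rw [← hx.agents, List.filterMap_map]
    rfl
  have hS (j : Fin m) : x.agents.S j = (G.ask (List.finRange m))^[(encode ⟨m, G⟩).length]
      (fun _ => false) j := by
    rw [← hr.choice j, State.choice, hr.cur]
    simp
  have hlive := hr.live
  rw [e]
  generalize x.agents = A at hS hlive ⊢
  generalize (encode ⟨m, G⟩).length = N at hm ⊢
  obtain ⟨d, rfl⟩ := Nat.exists_eq_add_of_le hm.le
  -- The first `m` cells are live and yield the choices; the other `d` cells yield no output.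
  rw [List.range_add, List.map_append, List.filterMap_append,
    (List.filterMap_eq_nil_iff (l := List.map A.cell (List.map _ _))).2
      (by simp [Agents.cell, hlive]),
    List.append_nil, ← List.map_coe_finRange_eq_range, List.map_map, List.filterMap_map,
    List.ofFn_eq_map, ← List.filterMap_eq_map]
  refine List.filterMap_congr fun j _ => ?_
  simp [Agents.cell, hlive, hS, equilibrium, strategy]

end SocialNetworkGame

theorem mainTheorem3 :
    (∀ (V : Type*) [Fintype V] [DecidableEq V] (G : SocialNetworkGame ℝ V 2),
      ∃ s : V → Fin 2, G.IsNash s) ∧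
    ∃ find : (n : ℕ) → SocialNetworkGame ℚ (Fin n) 2 → (Fin n → Fin 2),
      (∀ (n : ℕ) (G : SocialNetworkGame ℚ (Fin n) 2), G.IsNash (find n G)) ∧
      Nonempty (Turing.TM2ComputableInPolyTime
        (SocialNetworkGame.encode (h := 2)) (id : List (Fin 2) → List (Fin 2))
        (fun G => List.ofFn (find G.1 G.2))) :=
  ⟨fun _ _ _ G => G.exists_isNash, SocialNetworkGame.equilibrium,
    SocialNetworkGame.isNash_equilibrium,
    SocialNetworkGame.program.nonempty_computableInPolyTime _ _ fun G =>
      SocialNetworkGame.eval_program G.1 G.2⟩
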